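/- Theorem (Entropic Wasserstein Marginal Complexity). Let $\mathcal{X}\subset\mathbb{R}^d$ be compact, $\rho$ a Borel probability measure on $\mathcal{X}$, and $K_0,K_1:\mathcal{X}\times\mathcal{X}\to\mathbb{R}$ continuous, symmetric, positive semidefinite kernels. Write $K_i$ also for the covariance operator on $L^2(\mathcal{X},\rho)$ given by $[K_i\phi](x)=\int_{\mathcal{X}}K_i(x,s)\phi(s)\,d\rho(s)$, and let $\kappa_i=\sup_{x,y\in\mathcal{X}}|K_i(x,y)|$. For $\epsilon>0$ put $$M_\epsilon(K_0,K_1)=-I+\Big(I+\tfrac{16}{\epsilon^2}K_0^{1/2}K_1K_0^{1/2}\Big)^{1/2}$$ and define the entropy-regularized squared $2$-Wasserstein distance between the covariance operators by $$W_{2,\epsilon}^2(K_0,K_1)=\mathrm{Tr}[K_0]+\mathrm{Tr}[K_1]+\tfrac{\epsilon}{2}\log\det\big(I+\tfrac12 M_\epsilon(K_0,K_1)\big)-\tfrac{\epsilon}{2}\mathrm{Tr}[M_\epsilon(K_0,K_1)],$$ where $\det$ is the Fredholm determinant. Let $n\ge 1$, let $x_1,\dots,x_n$ be i.i.d. samples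 from $\rho$, let $\Sigma_{i}^{(n)}=\big(\tfrac1n K_i(x_j,x_k)\big)_{j,k=1}^n$, and define the $n$-marginal estimator by $$W_{2,\epsilon}^2(K_0,K_1,n)=\mathrm{Tr}\big[\Sigma_0^{(n)}+\Sigma_1^{(n)}\big]-\tfrac{\epsilon}{2}F\big(\tfrac{16}{\epsilon^2}\Sigma_0^{(n)}\Sigma_1^{(n)}\big),$$ $$F(A)=\mathrm{Tr}\big[-I+(I+A)^{1/2}\big]-\log\det\big(\tfrac12 I+\tfrac12(I+A)^{1/2}\big),$$ where $(I+A)^{1/2}$ is the principal square root. Then $|W_{2,\epsilon}^2(K_0,K_1)-W_{2,\epsilon}^2(K_0,K_1,n)|$ is integrable and $$\mathbb{E}\left|W_{2,\epsilon}^2(K_0,K_1)-W_{2,\epsilon}^2(K_0,K_1,n)\right|\le\frac{1}{\sqrt n}\left(\kappa_0+\kappa_1+\frac{8}{\epsilon}\kappa_0\kappa_1\right).$$ -/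

import Mathlib

open MeasureTheory ProbabilityTheory

noncomputable section

namespace EntropicW

section Operators

variable {H : Type*} [NormedAddCommGroup H] [InnerProductSpace ℝ H] [CompleteSpace H]

open Classical in
/-- The positive square root of a positive bounded operator `A` on a real Hilbert space: the
(unique) positive operator `B` with `B² = A`. -/
def opSqrt (A : H →L[ℝ] H) : H →L[ℝ] H :=
  if h : ∃ B : H →L[ℝ] H, B.IsPositive ∧ B * B = A then h.choose else 0

/-- The trace `Tr A = ∑ₖ ⟪A eₖ, eₖ⟫` over an orthonormal (Hilbert) basis `e` of `H`; for trace-class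
operators the value does not depend on the basis. -/
def opTrace (A : H →L[ℝ] H) : ℝ :=
  ∑' i, inner ℝ (A ((exists_hilbertBasis ℝ H).choose_spec.choose i))
    ((exists_hilbertBasis ℝ H).choose_spec.choose i)

/-- The Fredholm determinant `det (I + T) = ∏ₖ (1 + λₖ)` of `I + T`, for a self-adjoint trace-class
operator `T` whose eigenvalues, counted with multiplicity, are `λₖ`. (A real number that is not a
nonzero eigenvalue contributes the factor `1`.) -/
def fredholmDet (T : H →L[ℝ] H) : ℝ :=
  ∏' μ : ℝ, (1 + μ) ^ Module.finrank ℝ (Module.End.eigenspace (T : H →ₗ[ℝ] H) μ)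

/-- `M_ε(A, B) = -I + (I + (16 / ε²) A^{1/2} B A^{1/2})^{1/2}`. -/
def opM (ε : ℝ) (A B : H →L[ℝ] H) : H →L[ℝ] H :=
  -1 + opSqrt (1 + (16 / ε ^ 2) • (opSqrt A * B * opSqrt A))

/-- The entropy-regularized squared 2-Wasserstein distance `W²_{2,ε}(A, B)` between two covariance
operators. -/
def entropicWassersteinSq (ε : ℝ) (A B : H →L[ℝ] H) : ℝ :=
  opTrace A + opTrace B + ε / 2 * Real.log (fredholmDet ((1 / 2 : ℝ) • opM ε A B))
    - ε / 2 * opTrace (opM ε A B)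

end Operators

section Covariance

variable {𝒳 : Type*} [TopologicalSpace 𝒳] [CompactSpace 𝒳]
  [MeasurableSpace 𝒳] [BorelSpace 𝒳]

lemma integral_kernel_eq_inner (ρ : Measure 𝒳) [IsProbabilityMeasure ρ] (K : C(𝒳 × 𝒳, ℝ))
    (φ : Lp ℝ 2 ρ) (x : 𝒳) :
    ∫ s, K (x, s) * φ s ∂ρ = inner ℝ (ContinuousMap.toLp 2 ρ ℝ (K.curry x)) φ := by
  rw [L2.inner_def]
  refine integral_congr_ae ?_
  filter_upwards [ContinuousMap.coeFn_toLp (p := 2) (𝕜 := ℝ) ρ (K.curry x)] with s hs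
  rw [hs]
  simp [mul_comm]

/-- The continuous function `x ↦ ∫ K(x, s) φ(s) dρ(s)`. -/
def kernelIntegral (ρ : Measure 𝒳) [IsProbabilityMeasure ρ] (K : C(𝒳 × 𝒳, ℝ))
    (φ : Lp ℝ 2 ρ) : C(𝒳, ℝ) where
  toFun x := ∫ s, K (x, s) * φ s ∂ρ
  continuous_toFun := by
    simp_rw [integral_kernel_eq_inner]
    fun_prop

/-- `kernelIntegral` as a linear map in `φ`. -/
def kernelIntegralLinear (ρ : Measure 𝒳) [IsProbabilityMeasure ρ] (K : C(𝒳 × 𝒳, ℝ)) :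
    Lp ℝ 2 ρ →ₗ[ℝ] C(𝒳, ℝ) where
  toFun := kernelIntegral ρ K
  map_add' φ ψ := by
    ext x
    change ∫ s, K (x, s) * (φ + ψ : Lp ℝ 2 ρ) s ∂ρ
      = ∫ s, K (x, s) * φ s ∂ρ + ∫ s, K (x, s) * ψ s ∂ρ
    simp only [integral_kernel_eq_inner, inner_add_right]
  map_smul' c φ := by
    ext x
    change ∫ s, K (x, s) * (c • φ : Lp ℝ 2 ρ) s ∂ρ = c * ∫ s, K (x, s) * φ s ∂ρ
    simp only [integral_kernel_eq_inner, inner_smul_right]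

/-- The covariance operator on `L²(𝒳, ρ)` of a continuous kernel `K`:
`[K φ](x) = ∫ K(x, s) φ(s) dρ(s)`. -/
def covarianceOperator (ρ : Measure 𝒳) [IsProbabilityMeasure ρ] (K : C(𝒳 × 𝒳, ℝ)) :
    Lp ℝ 2 ρ →L[ℝ] Lp ℝ 2 ρ :=
  (ContinuousMap.toLp 2 ρ ℝ).comp <|
    (kernelIntegralLinear ρ K).mkContinuous
      (‖(ContinuousMap.toLp 2 ρ ℝ : C(𝒳, ℝ) →L[ℝ] Lp ℝ 2 ρ)‖ * ‖K.curry‖)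
      (fun φ => by
        refine (ContinuousMap.norm_le _ (by positivity)).2 fun x => ?_
        change ‖∫ s, K (x, s) * φ s ∂ρ‖ ≤ _
        rw [integral_kernel_eq_inner]
        refine (norm_inner_le_norm _ _).trans ?_
        gcongr
        refine (ContinuousLinearMap.le_opNorm _ _).trans ?_
        gcongr
        exact ContinuousMap.norm_coe_le_norm K.curry x)

lemma covarianceOperator_ae_eq (ρ : Measure 𝒳) [IsProbabilityMeasure ρ] (K : C(𝒳 × 𝒳, ℝ))
    (φ : Lp ℝ 2 ρ) :
    covarianceOperator ρ K φ =ᵐ[ρ] fun x => ∫ s, K (x, s) * φ s ∂ρ :=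
  ContinuousMap.coeFn_toLp (p := 2) (𝕜 := ℝ) ρ (kernelIntegral ρ K φ)

end Covariance

section Matrices

open Classical in
/-- The principal square root of a real square matrix `A` without eigenvalues in `(-∞, 0]`: the
(unique) real matrix `B` with `B² = A` all of whose complex eigenvalues have positive real part.
`A` need not be symmetric. -/
def matSqrt {n : ℕ} (A : Matrix (Fin n) (Fin n) ℝ) : Matrix (Fin n) (Fin n) ℝ :=
  if h : ∃ B : Matrix (Fin n) (Fin n) ℝ, B * B = A ∧
      ∀ z ∈ spectrum ℂ (B.map (algebraMap ℝ ℂ)), 0 < z.re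
  then h.choose else 0

/-- `F(A) = Tr[-I + (I + A)^{1/2}] - log det(I/2 + (I + A)^{1/2}/2)`. -/
def matF {n : ℕ} (A : Matrix (Fin n) (Fin n) ℝ) : ℝ :=
  (-1 + matSqrt (1 + A)).trace
    - Real.log ((1 / 2 : ℝ) • (1 : Matrix (Fin n) (Fin n) ℝ) + (1 / 2 : ℝ) • matSqrt (1 + A)).det

/-- The rescaled covariance matrix `(1/n) K(xᵢ, xⱼ)` of the marginal at the points `x₁, …, xₙ`. -/
def empiricalCov {𝒳 : Type*} [TopologicalSpace 𝒳] {n : ℕ} (K : C(𝒳 × 𝒳, ℝ)) (x : Fin n → 𝒳) :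
    Matrix (Fin n) (Fin n) ℝ :=
  Matrix.of fun i j => 1 / (n : ℝ) * K (x i, x j)

/-- The `n`-marginal estimator `W²_{2,ε}(K₀, K₁, n)` computed from the points `x₁, …, xₙ`. -/
def entropicWassersteinSqEstimator {𝒳 : Type*} [TopologicalSpace 𝒳] {n : ℕ} (ε : ℝ)
    (K₀ K₁ : C(𝒳 × 𝒳, ℝ)) (x : Fin n → 𝒳) : ℝ :=
  (empiricalCov K₀ x + empiricalCov K₁ x).trace
    - ε / 2 * matF ((16 / ε ^ 2) • (empiricalCov K₀ x * empiricalCov K₁ x))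

end Matrices

/-- A covariance function (kernel): symmetric and positive semidefinite, i.e. all its finite Gram
matrices are positive semidefinite. -/
def IsCovarianceKernel {𝒳 : Type*} [TopologicalSpace 𝒳] (K : C(𝒳 × 𝒳, ℝ)) : Prop :=
  (Matrix.of fun x y => K (x, y)).PosSemidef

/-- `κ = sup_{x, y} |K(x, y)|`. -/
def kernelSup {𝒳 : Type*} [TopologicalSpace 𝒳] (K : C(𝒳 × 𝒳, ℝ)) : ℝ :=
  ⨆ p : 𝒳 × 𝒳, |K p|

end EntropicW

end

/-! Both quantities are one functional of a Hilbert–Schmidt operator, evaluated once at a mean and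
once at an empirical mean. Choose feature maps `φᵢ` with `⟪φᵢ x, φᵢ y⟫ = Kᵢ (x, y)`. Then `Kᵢ = Eᵢ
Eᵢ†` with `Eᵢ h = ⟪φᵢ(·), h⟫`, and the nonzero eigenvalues of `K₀^{1/2} K₁ K₀^{1/2}` are the squared
singular values of `C = E₀† E₁`. In the feature spaces `C` is the integral of `φ₀ ⊗ φ₁` against `ρ`.
The same computation for the marginal matrices gives its integral against the empirical measure, so
the two operators act between the same spaces.

With `c = 16 / ε²`, each value is the two traces minus `ε / 2` times the sum of `f = entropicFun c`
over the squared singular values. The function `f` is concave, vanishes at `0` and has slope at most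
`c / 4`. By Peierls' inequality the sum is the minimum of `∑ f(‖C gⱼ‖²)` over Hilbert bases `g`.
Testing one operator in the optimal basis of the other bounds the difference by `c / 4 * ‖C - C'‖ *
‖C + C'‖` in Hilbert–Schmidt norms (`IsSingularSystem.abs_tsum_entropicFun_sub_le`).

Finally, the empirical mean of a Hilbert-space-valued function bounded by `B` has mean error at most
`B / √n` (`integral_norm_sub_mean_le`). This is applied to the two diagonals, bounded by `κ₀` and
`κ₁`, and to `φ₀ ⊗ φ₁`, bounded by `√(κ₀ κ₁)`. -/

namespace EntropicW

open scoped InnerProductSpace ENNReal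

universe u v

/-! ### Hilbert bases, Hilbert–Schmidt sums, and the spectral theorem for compact operators. -/

section HilbertSpace

variable {H : Type*} [NormedAddCommGroup H] [InnerProductSpace ℝ H]
variable {G : Type*} [NormedAddCommGroup G] [InnerProductSpace ℝ G]
variable {ι κ : Type*}

lemma hasSum_inner_sq (b : HilbertBasis ι ℝ H) (x : H) :
    HasSum (fun i => ⟪b i, x⟫_ℝ ^ 2) (‖x‖ ^ 2) := by
  have h := b.hasSum_inner_mul_inner x x
  rw [real_inner_self_eq_norm_sq] at h
  refine h.congr_fun ?_
  intro i
  rw [real_inner_comm x, sq]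

lemma tsum_ofReal_inner_sq (b : HilbertBasis ι ℝ H) (x : H) :
    ∑' i, ENNReal.ofReal (⟪b i, x⟫_ℝ ^ 2) = ENNReal.ofReal (‖x‖ ^ 2) := by
  have h := hasSum_inner_sq b x
  rw [← h.tsum_eq, ENNReal.ofReal_tsum_of_nonneg (fun _ => sq_nonneg _) h.summable]

/-- The squared Hilbert–Schmidt norm of an operator, computed in a Hilbert basis, agrees with
that of its adjoint, computed in any other Hilbert basis. -/
lemma tsum_norm_sq_adjoint [CompleteSpace H] [CompleteSpace G] (b : HilbertBasis ι ℝ H) (h : HilbertBasis κ ℝ G) (T : H →L[ℝ] G) :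
    ∑' i, ENNReal.ofReal (‖T (b i)‖ ^ 2)
      = ∑' j, ENNReal.ofReal (‖T.adjoint (h j)‖ ^ 2) := by
  -- Both sides are the double sum of the squared matrix entries of `T`; in `ℝ≥0∞` the order of
  -- summation is free.
  simp_rw [← tsum_ofReal_inner_sq h, ← tsum_ofReal_inner_sq b]
  rw [ENNReal.tsum_comm]
  simp_rw [ContinuousLinearMap.adjoint_inner_right, real_inner_comm]

lemma ext_hilbertBasis (b : HilbertBasis ι ℝ H) {S T : H →L[ℝ] G}
    (hST : ∀ i, S (b i) = T (b i)) : S = T := by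
  refine ContinuousLinearMap.ext_on (s := Set.range b) ?_ ?_
  · exact Submodule.dense_iff_topologicalClosure_eq_top.2 b.dense_span
  · rintro _ ⟨i, rfl⟩
    exact hST i

/-- The operator which is diagonal in a Hilbert basis, with given bounded eigenvalues. -/
lemma exists_diagonal [CompleteSpace H] (b : HilbertBasis ι ℝ H) (d : ι → ℝ) {C : ℝ} (hd : ∀ i, |d i| ≤ C) :
    ∃ D : H →L[ℝ] H, (∀ i, D (b i) = d i • b i) ∧ D.IsSymmetric ∧
      ((∀ i, 0 ≤ d i) → D.IsPositive) := by
  classical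
  have hmem (x : H) : Memℓp (fun i => d i * b.repr x i) 2 := by
    have := (memℓp_gen_iff (by norm_num)).1 (lp.memℓp (b.repr x))
    refine memℓp_gen (Summable.of_nonneg_of_le (fun i => by positivity) (fun i => ?_)
      (this.mul_left (C ^ 2)))
    simp only [norm_mul, ENNReal.toReal_ofNat, Real.rpow_ofNat, mul_pow]
    gcongr
    exact hd i
  let L : H →ₗ[ℝ] H :=
    { toFun := fun x => b.repr.symm ⟨fun i => d i * b.repr x i, hmem x⟩
      map_add' := fun x y => by
        rw [← map_add]
        congr 1
        ext i
        exact (congrArg (d i * ·) (by simp)).trans (mul_add _ _ _)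
      map_smul' := fun c x => by
        rw [RingHom.id_apply, ← map_smul]
        congr 1
        ext i
        simp [mul_left_comm] }
  have hL (x : H) (i : ι) : ⟪b i, L x⟫_ℝ = d i * ⟪b i, x⟫_ℝ := by
    rw [← b.repr_apply_apply, ← b.repr_apply_apply]
    simp [L]
  have hCnn (i : ι) : 0 ≤ C := (abs_nonneg _).trans (hd i)
  let D : H →L[ℝ] H := L.mkContinuous |C| fun x => by
    refine le_of_sq_le_sq ?_ (by positivity)
    rw [mul_pow]
    refine hasSum_le (fun i => ?_) (hasSum_inner_sq b (L x)) ((hasSum_inner_sq b x).mul_left _)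
    rw [hL, mul_pow, sq_abs]
    gcongr ?_ * _
    exact sq_le_sq' (by have := abs_le.1 (hd i); linarith) (abs_le.1 (hd i)).2
  have hD (x : H) (i : ι) : ⟪b i, D x⟫_ℝ = d i * ⟪b i, x⟫_ℝ := hL x i
  have hsymm : D.IsSymmetric := fun x y => by
    have h1 := b.hasSum_inner_mul_inner (D x) y
    have h2 := b.hasSum_inner_mul_inner x (D y)
    refine h1.unique (h2.congr_fun fun i => ?_)
    rw [real_inner_comm, hD, hD, real_inner_comm x]
    ring
  refine ⟨D, fun i => ?_, hsymm, fun h0 => ⟨hsymm, fun x => ?_⟩⟩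
  · refine b.repr.injective ?_
    ext j
    rw [b.repr_apply_apply, b.repr_apply_apply, hD, inner_smul_right]
    by_cases hij : j = i
    · rw [hij]
    · rw [b.orthonormal.2 hij, mul_zero, mul_zero]
  · have h1 := b.hasSum_inner_mul_inner (D x) x
    refine h1.nonneg fun i => ?_
    rw [real_inner_comm, hD, mul_assoc]
    exact mul_nonneg (h0 i) (mul_self_nonneg _)

/-- A compact symmetric operator has a Hilbert basis of eigenvectors. -/
lemma exists_eigenbasis {H : Type u} [NormedAddCommGroup H] [InnerProductSpace ℝ H]
    [CompleteSpace H] (T : H →L[ℝ] H) (hT : IsCompactOperator T) (hT' : T.IsSymmetric) :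
    ∃ (ι : Type u) (b : HilbertBasis ι ℝ H) (l : ι → ℝ), ∀ i, T (b i) = l i • b i := by
  have hE (μ : ℝ) : ∃ (w : Set (Module.End.eigenspace (T : H →ₗ[ℝ] H) μ))
      (b : HilbertBasis w ℝ (Module.End.eigenspace (T : H →ₗ[ℝ] H) μ)), ⇑b = ((↑) : w → _) :=
    haveI : CompleteSpace (Module.End.eigenspace (T : H →ₗ[ℝ] H) μ) := by
      have : IsClosed ((Module.End.eigenspace (T : H →ₗ[ℝ] H) μ : Submodule ℝ H) : Set H) := by
        have : ((Module.End.eigenspace (T : H →ₗ[ℝ] H) μ : Submodule ℝ H) : Set H)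
            = {x | T x = μ • x} := by
          ext x
          simp
        rw [this]
        exact isClosed_eq T.continuous (continuous_const_smul μ)
      exact this.completeSpace_coe
    exists_hilbertBasis _ _
  choose w b hb using hE
  have hV := LinearMap.IsSymmetric.orthogonalFamily_eigenspaces (T := (T : H →ₗ[ℝ] H)) hT'
  have hv := hV.orthonormal_sigma_orthonormal (fun μ => (b μ).orthonormal)
  have hbot := ContinuousLinearMap.orthogonalComplement_iSup_eigenspaces_eq_bot hT hT'
  refine ⟨Σ μ : ℝ, w μ, HilbertBasis.mkOfOrthogonalEqBot hv ?_, fun i => i.1, fun i => ?_⟩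
  · rw [eq_bot_iff, ← hbot]
    refine fun x hx => (Submodule.mem_orthogonal _ _).2 fun y hy => ?_
    -- A vector orthogonal to the chosen basis of each eigenspace is orthogonal to the whole
    -- eigenspace, by continuity of the inner product along the basis expansion.
    have key : (⨆ μ, Module.End.eigenspace (T : H →ₗ[ℝ] H) μ) ≤ (ℝ ∙ x)ᗮ := by
      refine iSup_le fun μ z hz => ?_
      rw [Submodule.mem_orthogonal_singleton_iff_inner_right]
      have hs := ((b μ).hasSum_repr ⟨z, hz⟩).mapL
        ((innerSL ℝ x).comp (Module.End.eigenspace (T : H →ₗ[ℝ] H) μ).subtypeL)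
      refine hs.unique ?_
      convert hasSum_zero using 2 with j
      have := (Submodule.mem_orthogonal _ _).1 hx
        ((b μ j : Module.End.eigenspace (T : H →ₗ[ℝ] H) μ) : H)
        (Submodule.subset_span ⟨⟨μ, j⟩, rfl⟩)
      replace this : ⟪x, ((b μ j : Module.End.eigenspace (T : H →ₗ[ℝ] H) μ) : H)⟫_ℝ = 0 := by
        rw [real_inner_comm]
        exact this
      simp [this]
    have := key hy
    rwa [Submodule.mem_orthogonal_singleton_iff_inner_left] at this
  · rw [HilbertBasis.coe_mkOfOrthogonalEqBot]
    exact Module.End.mem_eigenspace_iff.1 (b i.1 i.2).2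

/-- A Hilbert–Schmidt operator is compact. -/
lemma isCompactOperator_of_summable [CompleteSpace G] (b : HilbertBasis ι ℝ H) (T : H →L[ℝ] G)
    (hT : Summable fun i => ‖T (b i)‖ ^ 2) : IsCompactOperator T := by
  -- `T` is the norm limit of the finite-rank sums of the `R i`: Cauchy–Schwarz and Bessel bound a
  -- partial sum by its Hilbert–Schmidt norm, which gives the Cauchy criterion.
  let R (i : ι) : H →L[ℝ] G := (innerSL ℝ (b i)).smulRight (T (b i))
  have hR (s : Finset ι) : ‖∑ i ∈ s, R i‖ ≤ √(∑ i ∈ s, ‖T (b i)‖ ^ 2) := by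
    refine ContinuousLinearMap.opNorm_le_bound _ (Real.sqrt_nonneg _) fun x => ?_
    rw [sum_apply]
    calc ‖∑ i ∈ s, R i x‖ ≤ ∑ i ∈ s, ‖T (b i)‖ * |⟪b i, x⟫_ℝ| := by
          refine (norm_sum_le _ _).trans (le_of_eq (Finset.sum_congr rfl fun i _ => ?_))
          simp [R, norm_smul, mul_comm]
      _ ≤ √(∑ i ∈ s, ‖T (b i)‖ ^ 2) * √(∑ i ∈ s, |⟪b i, x⟫_ℝ| ^ 2) :=
          Real.sum_mul_le_sqrt_mul_sqrt _ _ _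
      _ ≤ √(∑ i ∈ s, ‖T (b i)‖ ^ 2) * ‖x‖ := by
          gcongr
          refine Real.sqrt_le_iff.2 ⟨norm_nonneg _, ?_⟩
          simp_rw [sq_abs]
          exact sum_le_hasSum s (fun _ _ => sq_nonneg _) (hasSum_inner_sq b x)
  have hsum : Summable R := by
    rw [summable_iff_vanishing_norm]
    intro δ hδ
    obtain ⟨s, hs⟩ := summable_iff_vanishing_norm.1 hT (δ ^ 2) (by positivity)
    refine ⟨s, fun t ht => (hR t).trans_lt ?_⟩
    rw [Real.sqrt_lt' hδ]
    exact (le_abs_self _).trans_lt (hs t ht)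
  have hTR : T = ∑' i, R i := by
    classical
    refine ext_hilbertBasis b fun j => ?_
    have h1 := (hsum.hasSum.mapL (ContinuousLinearMap.apply ℝ G (b j)))
    refine HasSum.unique ?_ h1
    convert hasSum_ite_eq j (T (b j)) using 2 with i
    have := orthonormal_iff_ite.1 b.orthonormal i j
    by_cases hij : i = j
    · subst hij
      simp [R, b.orthonormal.1 i]
    · simp [R, this, hij]
  have : Filter.Tendsto (fun s : Finset ι => ∑ i ∈ s, R i) Filter.atTop (nhds T) := by
    conv => rhs; rw [hTR]
    exact hsum.hasSum
  refine isCompactOperator_of_tendsto this (Filter.Eventually.of_forall fun s => ?_)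
  rw [FunLike.coe_sum]
  refine Finset.sum_induction (fun i => ⇑(R i)) IsCompactOperator (fun _ _ ha hb => ha.add hb)
    isCompactOperator_zero fun i _ => ?_
  exact (((isCompactOperator_id_iff_finiteDimensional (𝕜 := ℝ) (E := ℝ)).2 inferInstance).clm_comp
    (ContinuousLinearMap.toSpanSingleton ℝ (T (b i)))).comp_clm (innerSL ℝ (b i))

end HilbertSpace

/-! ### Trace, Fredholm determinant and square root in an eigenbasis. -/

section SpectralFunctions

variable {H : Type*} [NormedAddCommGroup H] [InnerProductSpace ℝ H]
variable {G : Type*} [NormedAddCommGroup G] [InnerProductSpace ℝ G]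
variable {ι κ : Type*}

lemma hasSum_of_tsum_ofReal_eq {f : ι → ℝ} (hf : ∀ i, 0 ≤ f i) {s : ℝ} (hs : 0 ≤ s)
    (h : ∑' i, ENNReal.ofReal (f i) = ENNReal.ofReal s) : HasSum f s := by
  have hsum : Summable f := by
    have := ENNReal.summable_toReal (f := fun i => ENNReal.ofReal (f i)) (by rw [h]; simp)
    simpa [ENNReal.toReal_ofReal, hf] using this
  rw [← ENNReal.ofReal_tsum_of_nonneg hf hsum,
    ENNReal.ofReal_eq_ofReal_iff (tsum_nonneg hf) hs] at h
  exact h ▸ hsum.hasSum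

/-- The trace of a positive operator `T T†`, computed from the values of `T†` or of `T`. -/
lemma opTrace_comp_adjoint [CompleteSpace H] [CompleteSpace G] (b : HilbertBasis ι ℝ H) (T : H →L[ℝ] G)
    (hT : Summable fun i => ‖T (b i)‖ ^ 2) :
    opTrace (T ∘L T.adjoint) = ∑' i, ‖T (b i)‖ ^ 2 := by
  set e := (exists_hilbertBasis ℝ G).choose_spec.choose with he
  have h := tsum_norm_sq_adjoint b e T
  rw [← ENNReal.ofReal_tsum_of_nonneg (fun _ => sq_nonneg _) hT] at h
  have h' := hasSum_of_tsum_ofReal_eq (fun _ => sq_nonneg _) (tsum_nonneg fun _ => sq_nonneg _)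
    h.symm
  rw [← h'.tsum_eq, opTrace, ← he]
  refine tsum_congr fun j => ?_
  rw [ContinuousLinearMap.comp_apply, ← ContinuousLinearMap.adjoint_inner_right,
    real_inner_self_eq_norm_sq]

/-- The trace of an operator with a Hilbert basis of eigenvectors and nonnegative summable
eigenvalues is the sum of its eigenvalues. -/
lemma opTrace_eq_tsum [CompleteSpace H] (b : HilbertBasis ι ℝ H) {D : H →L[ℝ] H} {d : ι → ℝ}
    (hD : ∀ i, D (b i) = d i • b i) (hd : ∀ i, 0 ≤ d i) (hs : Summable d) :
    opTrace D = ∑' i, d i := by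
  -- `opTrace` is computed in a basis unrelated to `b`. Writing `D = N N†` with `N` diagonal turns
  -- it into a Hilbert–Schmidt norm, which does not depend on the basis.
  obtain ⟨N, hN, hsymm, -⟩ := exists_diagonal b (fun i => √(d i)) (C := √(∑' i, d i)) fun i => by
    rw [abs_of_nonneg (Real.sqrt_nonneg _)]
    exact Real.sqrt_le_sqrt (hs.le_tsum i fun j _ => hd j)
  have hadj : N.adjoint = N := hsymm.isSelfAdjoint.adjoint_eq
  have hNN : D = N ∘L N.adjoint := ext_hilbertBasis b fun i => by
    rw [hadj, ContinuousLinearMap.comp_apply, hN, map_smul, hN, smul_smul,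
      Real.mul_self_sqrt (hd i), hD]
  have hnorm (i : ι) : ‖N (b i)‖ ^ 2 = d i := by
    rw [hN, norm_smul, b.orthonormal.1 i, mul_one, Real.norm_eq_abs, sq_abs, Real.sq_sqrt (hd i)]
  rw [hNN, opTrace_comp_adjoint b N (by simpa only [hnorm] using hs)]
  simp_rw [hnorm]

/-- The eigenspace of a diagonal operator for an eigenvalue `μ` is spanned by the basis vectors
with eigenvalue `μ`. -/
lemma finrank_eigenspace (b : HilbertBasis ι ℝ H) {D : H →L[ℝ] H} {d : ι → ℝ}
    (hD : ∀ i, D (b i) = d i • b i) (hsymm : D.IsSymmetric) (μ : ℝ) (s : Finset ι)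
    (hs : ∀ i, i ∈ s ↔ d i = μ) :
    Module.finrank ℝ (Module.End.eigenspace (D : H →ₗ[ℝ] H) μ) = s.card := by
  have hli : LinearIndependent ℝ (fun i : s => b i) :=
    (b.orthonormal.comp _ Subtype.val_injective).linearIndependent
  have hspan : Module.End.eigenspace (D : H →ₗ[ℝ] H) μ
      = Submodule.span ℝ (Set.range fun i : s => b i) := by
    refine le_antisymm (fun x hx => ?_) (Submodule.span_le.2 ?_)
    · rw [Module.End.mem_eigenspace_iff, ContinuousLinearMap.coe_coe] at hx
      have hz (i : ι) (hi : i ∉ s) : b.repr x i • b i = 0 := by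
        have h1 : (d i - μ) * ⟪b i, x⟫_ℝ = 0 := by
          rw [sub_mul, sub_eq_zero, ← real_inner_smul_left, ← hD, ← real_inner_smul_right, ← hx]
          exact hsymm _ _
        rw [b.repr_apply_apply, (mul_eq_zero.1 h1).resolve_left, zero_smul]
        rw [sub_eq_zero]
        exact fun h => hi ((hs i).2 h)
      rw [(b.hasSum_repr x).unique (hasSum_sum_of_ne_finset_zero fun i hi => hz i hi)]
      exact Submodule.sum_mem _ fun i hi =>
        Submodule.smul_mem _ _ (Submodule.subset_span ⟨⟨i, hi⟩, rfl⟩)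
    · rintro _ ⟨i, rfl⟩
      rw [SetLike.mem_coe, Module.End.mem_eigenspace_iff, ContinuousLinearMap.coe_coe, hD,
        (hs i).1 i.2]
  rw [hspan, finrank_span_eq_card hli, Fintype.card_coe]

/-- The Fredholm determinant of an operator with a Hilbert basis of eigenvectors and nonnegative
summable eigenvalues. -/
lemma log_fredholmDet_eq_tsum (b : HilbertBasis ι ℝ H) {D : H →L[ℝ] H} {d : ι → ℝ}
    (hD : ∀ i, D (b i) = d i • b i) (hsymm : D.IsSymmetric) (hd : ∀ i, 0 ≤ d i)
    (hs : Summable d) :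
    Real.log (fredholmDet D) = ∑' i, Real.log (1 + d i) := by
  have hlog : Summable fun i => Real.log (1 + d i) :=
    Summable.of_nonneg_of_le (fun i => Real.log_nonneg (by linarith [hd i]))
      (fun i => by linarith [Real.log_le_sub_one_of_pos (show 0 < 1 + d i by linarith [hd i])]) hs
  -- The determinant is a product over real numbers with multiplicities, so the eigenvalues are
  -- grouped by value.
  have hfib := HasSum.tsum_fiberwise hlog.hasSum d
  have hpow (μ : ℝ) :
      Real.exp (∑' i : d ⁻¹' {μ}, Real.log (1 + d i))
        = (1 + μ) ^ Module.finrank ℝ (Module.End.eigenspace (D : H →ₗ[ℝ] H) μ) := by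
    -- The fibre over `0` may be infinite, but its factor is a power of `1`. All other fibres are
    -- finite by summability.
    by_cases hμ : μ = 0
    · have (i : d ⁻¹' {μ}) : Real.log (1 + d i) = 0 := by
        rw [show d i = μ from i.2, hμ]
        simp
      simp [this, hμ]
    · have hfin : (d ⁻¹' {μ}).Finite := by
        have := hs.tendsto_cofinite_zero.eventually_ne (Ne.symm hμ)
        refine (Filter.eventually_cofinite.1 this).subset fun i hi => ?_
        simpa using hi
      rw [finrank_eigenspace b hD hsymm μ hfin.toFinset (by simp)]
      have hc (i : d ⁻¹' {μ}) : Real.log (1 + d i) = Real.log (1 + μ) := by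
        rw [show d i = μ from i.2]
      have := hfin.fintype
      simp_rw [hc]
      rw [tsum_fintype, Finset.sum_const, nsmul_eq_mul, Real.exp_nat_mul]
      have hcard : (Finset.univ : Finset (d ⁻¹' {μ})).card = hfin.toFinset.card := by
        rw [hfin.card_toFinset, Finset.card_univ]
      rw [hcard]
      -- Over an empty fibre `1 + μ` need not be positive, so `exp (log (1 + μ))` cannot be
      -- simplified; there the exponent `0` settles the claim.
      by_cases h0 : hfin.toFinset.card = 0
      · rw [h0, pow_zero, pow_zero]
      · obtain ⟨i, hi⟩ := Finset.card_ne_zero.1 h0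
        rw [Real.exp_log]
        have : d i = μ := by simpa using hi
        linarith [hd i]
  have hprod := hfib.rexp
  have : (Real.exp ∘ fun μ => ∑' i : d ⁻¹' {μ}, Real.log (1 + d i))
      = fun μ => (1 + μ) ^ Module.finrank ℝ (Module.End.eigenspace (D : H →ₗ[ℝ] H) μ) :=
    funext hpow
  rw [this] at hprod
  rw [fredholmDet, hprod.tprod_eq, Real.log_exp]

lemma opSqrt_spec {A : H →L[ℝ] H} (h : ∃ B : H →L[ℝ] H, B.IsPositive ∧ B * B = A) :
    (opSqrt A).IsPositive ∧ opSqrt A * opSqrt A = A := by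
  rw [opSqrt, dif_pos h]
  exact h.choose_spec

/-- The square root of a diagonal operator with nonnegative eigenvalues. -/
lemma exists_isPositive_sqrt [CompleteSpace H] (b : HilbertBasis ι ℝ H) {A : H →L[ℝ] H} {l : ι → ℝ}
    (hA : ∀ i, A (b i) = l i • b i) (hl : ∀ i, 0 ≤ l i) :
    ∃ B : H →L[ℝ] H, B.IsPositive ∧ B * B = A := by
  obtain ⟨B, hB, -, hpos⟩ := exists_diagonal b (fun i => √(l i)) (C := √‖A‖) fun i => by
    rw [abs_of_nonneg (Real.sqrt_nonneg _)]
    refine Real.sqrt_le_sqrt ?_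
    have := A.le_opNorm (b i)
    rwa [hA, norm_smul, b.orthonormal.1 i, mul_one, mul_one, Real.norm_of_nonneg (hl i)] at this
  refine ⟨B, hpos fun i => Real.sqrt_nonneg _, ext_hilbertBasis b fun i => ?_⟩
  rw [FunLike.coe_mul_eq_comp, Function.comp_apply, hB, map_smul, hB, smul_smul,
    Real.mul_self_sqrt (hl i), hA]

/-- This identifies the arbitrarily chosen root. If `B` is a positive root, `s = √(l i)` and `y = B
(b i) - s • b i`, then `B y = -s • y`, and positivity gives `s * ‖y‖² ≤ 0`. For `s = 0`, use `‖B (b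
i)‖² = ⟪b i, B² (b i)⟫ = 0` instead. -/
lemma opSqrt_apply_eigenvector [CompleteSpace H] (b : HilbertBasis ι ℝ H) {A : H →L[ℝ] H} {l : ι → ℝ}
    (hA : ∀ i, A (b i) = l i • b i) (hl : ∀ i, 0 ≤ l i) (i : ι) :
    opSqrt A (b i) = √(l i) • b i := by
  obtain ⟨hpos, hsq⟩ := opSqrt_spec (exists_isPositive_sqrt b hA hl)
  set B := opSqrt A
  set s := √(l i)
  set y := B (b i) - s • b i with hy
  have hBB : B (B (b i)) = (s * s) • b i := by
    rw [Real.mul_self_sqrt (hl i), ← hA, ← hsq, FunLike.coe_mul_eq_comp, Function.comp_apply]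
  have h1 : B y = -(s • y) := by
    rw [hy, map_sub, map_smul, hBB, smul_sub, smul_smul]
    abel
  have h2 : 0 ≤ ⟪B y, y⟫_ℝ := hpos.inner_nonneg_left y
  rw [h1, inner_neg_left, real_inner_smul_left, real_inner_self_eq_norm_sq] at h2
  have hs0 : 0 ≤ s := Real.sqrt_nonneg _
  rcases hs0.eq_or_lt with h0 | h0
  · have h3 : ‖B (b i)‖ ^ 2 = 0 := by
      rw [← real_inner_self_eq_norm_sq, hpos.isSymmetric.apply_clm, hBB, ← h0]
      simp
    rw [← h0, zero_smul, ← norm_eq_zero]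
    exact pow_eq_zero_iff two_ne_zero |>.1 h3
  · have : ‖y‖ ^ 2 = 0 := le_antisymm (by nlinarith) (sq_nonneg _)
    rw [← sub_eq_zero, ← norm_eq_zero]
    exact pow_eq_zero_iff two_ne_zero |>.1 this

end SpectralFunctions

/-! ### The concave scalar function. -/

/-- The scalar function `t ↦ √(1 + c t) - 1 - log((1 + √(1 + c t)) / 2)`. -/
noncomputable def entropicFun (c t : ℝ) : ℝ :=
  √(1 + c * t) - 1 - Real.log ((1 + √(1 + c * t)) / 2)

/-- The derivative of `entropicFun c`. -/
noncomputable def entropicSlope (c a : ℝ) : ℝ := c / (2 * (1 + √(1 + c * a)))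

section Scalar

variable {c a t : ℝ}

@[simp]
lemma entropicFun_zero (c : ℝ) : entropicFun c 0 = 0 := by
  norm_num [entropicFun]

lemma entropicSlope_nonneg (hc : 0 ≤ c) : 0 ≤ entropicSlope c a := by
  unfold entropicSlope
  positivity

/-- The slope is largest at `a = 0`, where the square root equals `1`. -/
lemma entropicSlope_le (hc : 0 ≤ c) (ha : 0 ≤ a) : entropicSlope c a ≤ c / 4 := by
  have : 1 ≤ √(1 + c * a) := Real.one_le_sqrt.2 (by nlinarith [mul_nonneg hc ha])
  exact div_le_div_of_nonneg_left hc (by norm_num) (by linarith)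

/-- Concavity of `entropicFun`, in the form of the tangent line inequality. -/
lemma entropicFun_le_tangent (hc : 0 ≤ c) (ha : 0 ≤ a) (ht : 0 ≤ t) :
    entropicFun c t ≤ entropicFun c a + entropicSlope c a * (t - a) := by
  have hct := mul_nonneg hc ht
  have hca := mul_nonneg hc ha
  have hs1 : 1 ≤ √(1 + c * t) := Real.one_le_sqrt.2 (by linarith)
  have hr1 : 1 ≤ √(1 + c * a) := Real.one_le_sqrt.2 (by linarith)
  have hs2 := Real.sq_sqrt (show 0 ≤ 1 + c * t by linarith)
  have hr2 := Real.sq_sqrt (show 0 ≤ 1 + c * a by linarith)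
  have hslope : entropicSlope c a * (t - a)
      = (√(1 + c * t) ^ 2 - √(1 + c * a) ^ 2) / (2 * (1 + √(1 + c * a))) := by
    rw [hs2, hr2, entropicSlope]
    ring
  rw [hslope, entropicFun, entropicFun]
  generalize √(1 + c * t) = s at *
  generalize √(1 + c * a) = r at *
  have hlog : Real.log ((1 + r) / 2) - Real.log ((1 + s) / 2) ≤ (1 + r) / (1 + s) - 1 := by
    rw [← Real.log_div (by positivity) (by positivity)]
    refine (Real.log_le_sub_one_of_pos (by positivity)).trans_eq ?_
    field_simp
  -- The gap is `(s - r)² (s - 1)` over a positive quantity, hence nonnegative because `s ≥ 1`.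
  have hkey : (1 + r) / (1 + s) - 1 ≤ r - s + (s ^ 2 - r ^ 2) / (2 * (1 + r)) := by
    have : r - s + (s ^ 2 - r ^ 2) / (2 * (1 + r)) - ((1 + r) / (1 + s) - 1)
        = (s - r) ^ 2 * (s - 1) / (2 * (1 + r) * (1 + s)) := by
      field_simp
      ring
    have h2 : 0 ≤ (s - r) ^ 2 * (s - 1) / (2 * (1 + r) * (1 + s)) :=
      div_nonneg (mul_nonneg (sq_nonneg _) (by linarith)) (by positivity)
    linarith
  linarith

/-- The tangent at `a` lies above the graph at `0`, so its intercept is nonnegative. Peierls'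
inequality needs this for weights of total mass below `1`. -/
lemma mul_entropicSlope_le (hc : 0 ≤ c) (ha : 0 ≤ a) :
    a * entropicSlope c a ≤ entropicFun c a := by
  have := entropicFun_le_tangent hc ha le_rfl
  rw [entropicFun_zero] at this
  linarith

lemma entropicFun_nonneg (hc : 0 ≤ c) (ha : 0 ≤ a) : 0 ≤ entropicFun c a :=
  (mul_nonneg ha (entropicSlope_nonneg hc)).trans (mul_entropicSlope_le hc ha)

lemma entropicFun_le_add (hc : 0 ≤ c) (ha : 0 ≤ a) (ht : 0 ≤ t) :
    entropicFun c t ≤ entropicFun c a + c / 4 * |t - a| := by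
  refine (entropicFun_le_tangent hc ha ht).trans ?_
  exact (add_le_add_iff_left _).2
    ((mul_le_mul_of_nonneg_left (le_abs_self _) (entropicSlope_nonneg hc)).trans
      (mul_le_mul_of_nonneg_right (entropicSlope_le hc ha) (abs_nonneg _)))

lemma entropicFun_le (hc : 0 ≤ c) (ht : 0 ≤ t) : entropicFun c t ≤ c / 4 * t := by
  simpa [abs_of_nonneg ht] using entropicFun_le_add hc le_rfl ht

lemma summable_entropicFun {ι : Type*} {l : ι → ℝ} (hc : 0 ≤ c) (hl : ∀ i, 0 ≤ l i)
    (hs : Summable l) : Summable fun i => entropicFun c (l i) :=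
  Summable.of_nonneg_of_le (fun i => entropicFun_nonneg hc (hl i))
    (fun i => entropicFun_le hc (hl i)) (hs.mul_left (c / 4))

end Scalar

/-! ### Singular values, Peierls' inequality and the Lipschitz estimate. -/

section Singular

variable {H : Type*} [NormedAddCommGroup H] [InnerProductSpace ℝ H]
variable {G : Type*} [NormedAddCommGroup G] [InnerProductSpace ℝ G]
variable {ι ι' κ : Type*}

/-- A system of right singular vectors of `C`, each scaled by its singular value: the `w i` are
pairwise orthogonal and `C† C = ∑ᵢ w i ⊗ w i`. -/
structure IsSingularSystem (C : H →L[ℝ] G) (w : ι → H) : Prop where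
  orthogonal : Pairwise fun i j => ⟪w i, w j⟫_ℝ = 0
  hasSum (h : H) : HasSum (fun i => ⟪w i, h⟫_ℝ ^ 2) (‖C h‖ ^ 2)

namespace IsSingularSystem

variable {C C' : H →L[ℝ] G} {w : ι → H} {w' : ι' → H}

/-- The normalized singular vectors. -/
lemma orthonormal (hw : IsSingularSystem C w) :
    Orthonormal ℝ (fun i : {i // w i ≠ 0} => ‖w i‖⁻¹ • w i) := by
  refine ⟨fun i => ?_, fun i j hij => ?_⟩
  · rw [norm_smul, norm_inv, norm_norm, inv_mul_cancel₀ (norm_ne_zero_iff.2 i.2)]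
  · change ⟪‖w i‖⁻¹ • w i, ‖w j‖⁻¹ • w j⟫_ℝ = 0
    rw [inner_smul_left, inner_smul_right, hw.orthogonal (fun h => hij (Subtype.ext h))]
    simp

/-- **Peierls' inequality** for the concave function `entropicFun c`. -/
lemma tsum_entropicFun_le (hw : IsSingularSystem C w) {c : ℝ} (hc : 0 ≤ c)
    (g : HilbertBasis κ ℝ H) :
    ∑' i, ENNReal.ofReal (entropicFun c (‖w i‖ ^ 2))
      ≤ ∑' j, ENNReal.ofReal (entropicFun c (‖C (g j)‖ ^ 2)) := by
  classical
  -- Squared coefficients of the normalized `w i` in the basis `g`. Rows with `w i ≠ 0` sum to `1`;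
  -- columns sum only to at most `1`, since the `w i` need not span.
  set p : ι → κ → ℝ := fun i j => ⟪w i, g j⟫_ℝ ^ 2 / ‖w i‖ ^ 2 with hp
  have hp0 (i : ι) (j : κ) : 0 ≤ p i j := by positivity
  have hf0 (i : ι) : 0 ≤ entropicFun c (‖w i‖ ^ 2) := entropicFun_nonneg hc (sq_nonneg _)
  have hrow (i : ι) : ENNReal.ofReal (entropicFun c (‖w i‖ ^ 2))
      ≤ ∑' j, ENNReal.ofReal (p i j * entropicFun c (‖w i‖ ^ 2)) := by
    by_cases hi : w i = 0
    · simp [hi]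
    · have h1 : HasSum (p i) 1 := by
        have h2 := (hasSum_inner_sq g (w i)).div_const (‖w i‖ ^ 2)
        rw [div_self (by positivity)] at h2
        simpa only [hp, real_inner_comm] using h2
      have h3 := h1.mul_right (entropicFun c (‖w i‖ ^ 2))
      rw [one_mul] at h3
      rw [← ENNReal.ofReal_tsum_of_nonneg (fun j => mul_nonneg (hp0 i j) (hf0 i)) h3.summable,
        h3.tsum_eq]
  have hcol (j : κ) : ∑' i, ENNReal.ofReal (p i j * entropicFun c (‖w i‖ ^ 2))
      ≤ ENNReal.ofReal (entropicFun c (‖C (g j)‖ ^ 2)) := by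
    refine ENNReal.summable.tsum_le_of_sum_le fun s => ?_
    rw [← ENNReal.ofReal_sum_of_nonneg fun i _ => mul_nonneg (hp0 i j) (hf0 i)]
    refine ENNReal.ofReal_le_ofReal ?_
    set a := ‖C (g j)‖ ^ 2
    have ha : 0 ≤ a := sq_nonneg _
    have hpw (i : ι) : p i j * ‖w i‖ ^ 2 = ⟪w i, g j⟫_ℝ ^ 2 := by
      by_cases hi : w i = 0
      · simp [hi]
      · exact div_mul_cancel₀ _ (by positivity)
    have hbessel : ∑ i ∈ s, p i j ≤ 1 := by
      have h1 := hw.orthonormal.sum_inner_products_le (g j) (s := s.subtype (fun i => w i ≠ 0))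
      rw [g.orthonormal.1 j, one_pow] at h1
      refine le_trans (le_of_eq ?_) h1
      have h2 : ∑ i ∈ s.subtype (fun i => w i ≠ 0), p i j = ∑ i ∈ s, p i j := by
        rw [Finset.sum_subtype_eq_sum_filter (fun i => p i j)]
        refine Finset.sum_filter_of_ne fun i _ hi h0 => hi ?_
        simp [hp, h0]
      rw [← h2]
      refine Finset.sum_congr rfl fun i _ => ?_
      rw [inner_smul_left, Real.norm_eq_abs, sq_abs, hp]
      simp [mul_pow, div_eq_inv_mul]
    have hsum : ∑ i ∈ s, ⟪w i, g j⟫_ℝ ^ 2 ≤ a :=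
      sum_le_hasSum s (fun _ _ => sq_nonneg _) (hw.hasSum (g j))
    -- Jensen through the tangent at `a = ‖C (g j)‖²`: the nonnegative intercept absorbs the missing
    -- mass, and `∑ p i j * ‖w i‖² ≤ a` controls the slope term.
    calc ∑ i ∈ s, p i j * entropicFun c (‖w i‖ ^ 2)
        ≤ ∑ i ∈ s, (p i j * (entropicFun c a - a * entropicSlope c a)
            + entropicSlope c a * ⟪w i, g j⟫_ℝ ^ 2) := by
          refine Finset.sum_le_sum fun i _ => ?_
          rw [← hpw]
          have := mul_le_mul_of_nonneg_left
            (entropicFun_le_tangent hc ha (sq_nonneg ‖w i‖)) (hp0 i j)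
          linarith
      _ = (∑ i ∈ s, p i j) * (entropicFun c a - a * entropicSlope c a)
            + entropicSlope c a * ∑ i ∈ s, ⟪w i, g j⟫_ℝ ^ 2 := by
          rw [Finset.sum_add_distrib, Finset.sum_mul, Finset.mul_sum]
      _ ≤ 1 * (entropicFun c a - a * entropicSlope c a) + entropicSlope c a * a := by
          gcongr
          · linarith [mul_entropicSlope_le hc ha]
          · exact entropicSlope_nonneg hc
      _ = entropicFun c a := by ring
  calc _ ≤ ∑' i, ∑' j, ENNReal.ofReal (p i j * entropicFun c (‖w i‖ ^ 2)) :=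
        ENNReal.tsum_le_tsum hrow
    _ = ∑' j, ∑' i, ENNReal.ofReal (p i j * entropicFun c (‖w i‖ ^ 2)) := ENNReal.tsum_comm
    _ ≤ _ := ENNReal.tsum_le_tsum hcol

/-- Equality is attained in Peierls' inequality at a Hilbert basis which extends the singular
vectors. -/
lemma exists_hilbertBasis {H : Type u} [NormedAddCommGroup H] [InnerProductSpace ℝ H]
    [CompleteSpace H] {C : H →L[ℝ] G} {w : ι → H} (hw : IsSingularSystem C w) (c : ℝ) :
    ∃ (κ : Type u) (g : HilbertBasis κ ℝ H),
      ∑' j, ENNReal.ofReal (entropicFun c (‖C (g j)‖ ^ 2))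
        = ∑' i, ENNReal.ofReal (entropicFun c (‖w i‖ ^ 2)) := by
  obtain ⟨W, g, hW, hg⟩ := hw.orthonormal.toSubtypeRange.exists_hilbertBasis_extension
  have hgj (j : W) : g j = (j : H) := congrFun hg j
  refine ⟨W, g, ?_⟩
  let e : {i // w i ≠ 0} → W := fun i => ⟨‖w i‖⁻¹ • w i, hW ⟨i, rfl⟩⟩
  have he : Function.Injective e := fun i i' h =>
    hw.orthonormal.linearIndependent.injective (congrArg Subtype.val h)
  -- A basis vector outside the normalized `w i` is orthogonal to all of them, so `C` kills it.
  have hzero (j : W) (hj : j ∉ Set.range e) : ‖C (g j)‖ ^ 2 = 0 := by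
    refine (hw.hasSum (g j)).unique ?_
    convert hasSum_zero using 2 with i
    by_cases hi : w i = 0
    · simp [hi]
    · have hne : e ⟨i, hi⟩ ≠ j := fun h => hj ⟨_, h⟩
      have h1 : ⟪g (e ⟨i, hi⟩), g j⟫_ℝ = 0 := g.orthonormal.2 hne
      rw [hgj, show ((e ⟨i, hi⟩ : W) : H) = ‖w i‖⁻¹ • w i from rfl, inner_smul_left] at h1
      have h2 : ‖w i‖⁻¹ ≠ 0 := inv_ne_zero (norm_ne_zero_iff.2 hi)
      rw [(mul_eq_zero.1 h1).resolve_left (by simpa using hi)]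
      simp
  have heq (i : {i // w i ≠ 0}) : ‖C (g (e i))‖ ^ 2 = ‖w i‖ ^ 2 := by
    refine (hw.hasSum (g (e i))).unique ?_
    convert hasSum_single (f := fun k => ⟪w k, g (e i)⟫_ℝ ^ 2) (i : ι) fun k hk => ?_ using 1
    · rw [hgj, show ((e i : W) : H) = ‖w i‖⁻¹ • w i from rfl, inner_smul_right,
        real_inner_self_eq_norm_sq]
      have := norm_ne_zero_iff.2 i.2
      field_simp
    · rw [hgj, show ((e i : W) : H) = ‖w i‖⁻¹ • w i from rfl, inner_smul_right,
        hw.orthogonal hk]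
      simp
  rw [← he.tsum_eq (f := fun j => ENNReal.ofReal (entropicFun c (‖C (g j)‖ ^ 2)))
    (Function.support_subset_iff'.2 fun j hj => by simp [hzero j hj])]
  simp_rw [heq]
  exact tsum_subtype_eq_of_support_subset (s := {i | w i ≠ 0})
    (f := fun i => ENNReal.ofReal (entropicFun c (‖w i‖ ^ 2)))
    (Function.support_subset_iff'.2 fun i hi => by simp [not_not.1 hi])

end IsSingularSystem

/-- Each difference of squares equals `⟪(C - C') (g j), (C + C') (g j)⟫`; apply Cauchy–Schwarz to
the inner product and then to the sum. -/
lemma tsum_ofReal_abs_norm_sq_sub_le {g : κ → H} {C C' : H →L[ℝ] G} {δ σ : ℝ} (hδ : 0 ≤ δ)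
    (hσ : 0 ≤ σ) (h1 : HasSum (fun j => ‖(C - C') (g j)‖ ^ 2) (δ ^ 2))
    (h2 : HasSum (fun j => ‖(C + C') (g j)‖ ^ 2) (σ ^ 2)) :
    ∑' j, ENNReal.ofReal |‖C (g j)‖ ^ 2 - ‖C' (g j)‖ ^ 2| ≤ ENNReal.ofReal (δ * σ) := by
  refine ENNReal.summable.tsum_le_of_sum_le fun s => ?_
  rw [← ENNReal.ofReal_sum_of_nonneg fun i _ => abs_nonneg _]
  refine ENNReal.ofReal_le_ofReal ?_
  calc ∑ j ∈ s, |‖C (g j)‖ ^ 2 - ‖C' (g j)‖ ^ 2|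
      ≤ ∑ j ∈ s, ‖(C - C') (g j)‖ * ‖(C + C') (g j)‖ := by
        refine Finset.sum_le_sum fun j _ => ?_
        have : ‖C (g j)‖ ^ 2 - ‖C' (g j)‖ ^ 2 = ⟪(C - C') (g j), (C + C') (g j)⟫_ℝ := by
          simp only [sub_apply, add_apply, inner_sub_left, inner_add_right,
            real_inner_self_eq_norm_sq, real_inner_comm (C (g j)) (C' (g j))]
          ring
        rw [this]
        exact abs_real_inner_le_norm _ _
    _ ≤ √(∑ j ∈ s, ‖(C - C') (g j)‖ ^ 2) * √(∑ j ∈ s, ‖(C + C') (g j)‖ ^ 2) :=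
        Real.sum_mul_le_sqrt_mul_sqrt _ _ _
    _ ≤ δ * σ := by
        gcongr
        · exact Real.sqrt_le_iff.2 ⟨hδ, sum_le_hasSum s (fun _ _ => sq_nonneg _) h1⟩
        · exact Real.sqrt_le_iff.2 ⟨hσ, sum_le_hasSum s (fun _ _ => sq_nonneg _) h2⟩

lemma hasSum_norm_sq_of_adjoint [CompleteSpace H] [CompleteSpace G] (h : HilbertBasis ι ℝ G)
    (g : HilbertBasis κ ℝ H) {T : H →L[ℝ] G} {δ : ℝ}
    (hT : HasSum (fun i => ‖T.adjoint (h i)‖ ^ 2) (δ ^ 2)) :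
    HasSum (fun j => ‖T (g j)‖ ^ 2) (δ ^ 2) := by
  refine hasSum_of_tsum_ofReal_eq (fun _ => sq_nonneg _) (sq_nonneg _) ?_
  rw [tsum_norm_sq_adjoint g h, ← hT.tsum_eq,
    ENNReal.ofReal_tsum_of_nonneg (fun _ => sq_nonneg _) hT.summable]

namespace IsSingularSystem

/-- Take `g` optimal for `C'`. Peierls bounds the sum for `C` by its sum along `g`, while equality
holds for `C'`; termwise, `f` is Lipschitz with constant `c / 4`. -/
lemma tsum_entropicFun_le_add {H : Type u} [NormedAddCommGroup H] [InnerProductSpace ℝ H]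
    [CompleteSpace H] [CompleteSpace G] {C C' : H →L[ℝ] G} {w : ι → H} {w' : ι' → H}
    (hw : IsSingularSystem C w) (hw' : IsSingularSystem C' w')
    (hs : Summable fun i => ‖w i‖ ^ 2) (hs' : Summable fun i => ‖w' i‖ ^ 2)
    {c : ℝ} (hc : 0 ≤ c) (h : HilbertBasis κ ℝ G) {δ σ : ℝ} (hδ : 0 ≤ δ) (hσ : 0 ≤ σ)
    (h1 : HasSum (fun j => ‖(C - C').adjoint (h j)‖ ^ 2) (δ ^ 2))
    (h2 : HasSum (fun j => ‖(C + C').adjoint (h j)‖ ^ 2) (σ ^ 2)) :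
    ∑' i, entropicFun c (‖w i‖ ^ 2)
      ≤ ∑' i, entropicFun c (‖w' i‖ ^ 2) + c / 4 * (δ * σ) := by
  obtain ⟨κ', g, hg⟩ := hw'.exists_hilbertBasis c
  have hf {t : ℝ} : 0 ≤ entropicFun c (t ^ 2) := entropicFun_nonneg hc (sq_nonneg _)
  have key : ∑' i, ENNReal.ofReal (entropicFun c (‖w i‖ ^ 2))
      ≤ ∑' i, ENNReal.ofReal (entropicFun c (‖w' i‖ ^ 2))
        + ENNReal.ofReal (c / 4) * ENNReal.ofReal (δ * σ) :=
    calc _ ≤ ∑' j, ENNReal.ofReal (entropicFun c (‖C (g j)‖ ^ 2)) :=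
          hw.tsum_entropicFun_le hc g
      _ ≤ ∑' j, (ENNReal.ofReal (entropicFun c (‖C' (g j)‖ ^ 2))
            + ENNReal.ofReal (c / 4) * ENNReal.ofReal |‖C (g j)‖ ^ 2 - ‖C' (g j)‖ ^ 2|) := by
          refine ENNReal.tsum_le_tsum fun j => ?_
          rw [← ENNReal.ofReal_mul (by positivity), ← ENNReal.ofReal_add hf (by positivity)]
          exact ENNReal.ofReal_le_ofReal (entropicFun_le_add hc (sq_nonneg _) (sq_nonneg _))
      _ ≤ _ := by
          rw [ENNReal.tsum_add, ENNReal.tsum_mul_left, hg]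
          gcongr
          exact tsum_ofReal_abs_norm_sq_sub_le hδ hσ (hasSum_norm_sq_of_adjoint h g h1)
            (hasSum_norm_sq_of_adjoint h g h2)
  rw [← ENNReal.ofReal_tsum_of_nonneg (fun _ => hf) (summable_entropicFun hc (fun _ => sq_nonneg _) hs),
    ← ENNReal.ofReal_tsum_of_nonneg (fun _ => hf) (summable_entropicFun hc (fun _ => sq_nonneg _) hs'),
    ← ENNReal.ofReal_mul (by positivity),
    ← ENNReal.ofReal_add (tsum_nonneg fun _ => hf) (by positivity),
    ENNReal.ofReal_le_ofReal_iff (add_nonneg (tsum_nonneg fun _ => hf) (by positivity))] at key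
  exact key

/-- The comparison of two operators: the sum of `entropicFun c` over the squared singular values is
Lipschitz, in the Hilbert–Schmidt norm, on bounded sets. -/
lemma abs_tsum_entropicFun_sub_le {H : Type u} [NormedAddCommGroup H] [InnerProductSpace ℝ H]
    [CompleteSpace H] [CompleteSpace G] {C C' : H →L[ℝ] G} {w : ι → H} {w' : ι' → H}
    (hw : IsSingularSystem C w) (hw' : IsSingularSystem C' w')
    (hs : Summable fun i => ‖w i‖ ^ 2) (hs' : Summable fun i => ‖w' i‖ ^ 2)
    {c : ℝ} (hc : 0 ≤ c) (h : HilbertBasis κ ℝ G) {δ σ : ℝ} (hδ : 0 ≤ δ) (hσ : 0 ≤ σ)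
    (h1 : HasSum (fun j => ‖(C - C').adjoint (h j)‖ ^ 2) (δ ^ 2))
    (h2 : HasSum (fun j => ‖(C + C').adjoint (h j)‖ ^ 2) (σ ^ 2)) :
    |∑' i, entropicFun c (‖w i‖ ^ 2) - ∑' i, entropicFun c (‖w' i‖ ^ 2)|
      ≤ c / 4 * (δ * σ) := by
  have h1' : HasSum (fun j => ‖(C' - C).adjoint (h j)‖ ^ 2) (δ ^ 2) := by
    rw [← neg_sub C C', map_neg]
    simpa only [FunLike.coe_neg, Pi.neg_apply, norm_neg] using h1
  rw [abs_sub_le_iff]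
  have := hw.tsum_entropicFun_le_add hw' hs hs' hc h hδ hσ h1 h2
  have := hw'.tsum_entropicFun_le_add hw hs' hs hc h hδ hσ h1' (by rwa [add_comm])
  constructor <;> linarith

end IsSingularSystem

end Singular

/-! ### The entropic distance of operators `E₀ E₀†` and `E₁ E₁†`. -/

section Factorization

variable {L : Type u} [NormedAddCommGroup L] [InnerProductSpace ℝ L] [CompleteSpace L]
variable {H₀ : Type*} [NormedAddCommGroup H₀] [InnerProductSpace ℝ H₀] [CompleteSpace H₀]
variable {H₁ : Type*} [NormedAddCommGroup H₁] [InnerProductSpace ℝ H₁] [CompleteSpace H₁]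
variable {ι κ κ₀ κ₁ : Type*}

/-- If `R` is a symmetric square root of `E₀ E₀†`, then the eigenvectors of `R E₁ E₁† R` give a
singular system of `E₀† E₁`, whose squared singular values are the eigenvalues. -/
lemma isSingularSystem_of_eigenbasis (E₀ : H₀ →L[ℝ] L) (E₁ : H₁ →L[ℝ] L) {R : L →L[ℝ] L}
    (hR : R.IsSymmetric) (hRR : R ∘L R = E₀ ∘L E₀.adjoint) (b : HilbertBasis ι ℝ L) {l : ι → ℝ}
    (hb : ∀ i, R (E₁ (E₁.adjoint (R (b i)))) = l i • b i) :
    IsSingularSystem (E₀.adjoint ∘L E₁) (fun i => E₁.adjoint (R (b i))) ∧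
      ∀ i, ‖E₁.adjoint (R (b i))‖ ^ 2 = l i := by
  have hin (i j : ι) : ⟪E₁.adjoint (R (b i)), E₁.adjoint (R (b j))⟫_ℝ = l i * ⟪b i, b j⟫_ℝ := by
    rw [ContinuousLinearMap.adjoint_inner_right, ← hR.apply_clm, hb, real_inner_smul_left]
  refine ⟨⟨fun i j hij => ?_, fun h => ?_⟩, fun i => ?_⟩
  · exact (hin i j).trans (by rw [b.orthonormal.2 hij, mul_zero])
  · have h1 : ‖(E₀.adjoint ∘L E₁) h‖ ^ 2 = ‖R (E₁ h)‖ ^ 2 := by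
      rw [← real_inner_self_eq_norm_sq, ← real_inner_self_eq_norm_sq,
        ContinuousLinearMap.comp_apply, ContinuousLinearMap.adjoint_inner_left,
        hR.apply_clm]
      exact congrArg _ (DFunLike.congr_fun hRR (E₁ h)).symm
    rw [h1]
    refine (hasSum_inner_sq b (R (E₁ h))).congr_fun fun i => ?_
    rw [ContinuousLinearMap.adjoint_inner_left, hR.apply_clm]
  · rw [← real_inner_self_eq_norm_sq, hin, real_inner_self_eq_norm_sq, b.orthonormal.1 i]
    simp

lemma summable_norm_sq_of_adjoint (h : HilbertBasis κ ℝ H₁) (b : HilbertBasis ι ℝ L)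
    {T : L →L[ℝ] H₁} (hT : Summable fun j => ‖T.adjoint (h j)‖ ^ 2) :
    Summable fun i => ‖T (b i)‖ ^ 2 := by
  refine (hasSum_of_tsum_ofReal_eq (s := ∑' j, ‖T.adjoint (h j)‖ ^ 2) (fun _ => sq_nonneg _)
    (tsum_nonneg fun _ => sq_nonneg _) ?_).summable
  rw [tsum_norm_sq_adjoint b h, ENNReal.ofReal_tsum_of_nonneg (fun _ => sq_nonneg _) hT]

/-- The sum defining `entropicWassersteinSq`, in terms of the eigenvalues of `A^{1/2} B A^{1/2}`. -/
lemma entropicWassersteinSq_eq_of_eigenbasis {A B : L →L[ℝ] L} (b : HilbertBasis ι ℝ L)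
    {l : ι → ℝ} (hb : ∀ i, (opSqrt A * B * opSqrt A) (b i) = l i • b i) (hl : ∀ i, 0 ≤ l i)
    (hs : Summable l) {ε : ℝ} (hε : 0 < ε) :
    entropicWassersteinSq ε A B
      = opTrace A + opTrace B - ε / 2 * ∑' i, entropicFun (16 / ε ^ 2) (l i) := by
  set c := 16 / ε ^ 2 with hc
  have hc0 : 0 ≤ c := by positivity
  have hcl (i : ι) : 0 ≤ c * l i := mul_nonneg hc0 (hl i)
  have hX (i : ι) : (1 + c • (opSqrt A * B * opSqrt A)) (b i) = (1 + c * l i) • b i := by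
    rw [add_apply, FunLike.coe_smul, Pi.smul_apply, hb, smul_smul, add_smul, one_smul]
    rfl
  have hX0 (i : ι) : 0 ≤ 1 + c * l i := by linarith [hcl i]
  have hM (i : ι) : opM ε A B (b i) = (√(1 + c * l i) - 1) • b i := by
    rw [opM, add_apply, opSqrt_apply_eigenvector b hX hX0, neg_apply, sub_smul, one_smul,
      add_comm, sub_eq_add_neg]
    rfl
  have hm0 (i : ι) : 0 ≤ √(1 + c * l i) - 1 :=
    sub_nonneg.2 (Real.one_le_sqrt.2 (by linarith [hcl i]))
  have hms : Summable fun i => √(1 + c * l i) - 1 := by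
    refine Summable.of_nonneg_of_le hm0 (fun i => ?_) (hs.mul_left c)
    have : √(1 + c * l i) ≤ 1 + c * l i :=
      Real.sqrt_le_iff.2 ⟨hX0 i, by nlinarith [hcl i]⟩
    linarith
  have hMsymm : (opM ε A B).IsSymmetric := by
    have h1 := (opSqrt_spec (exists_isPositive_sqrt b hX hX0)).1.isSelfAdjoint
    have h2 : IsSelfAdjoint (opM ε A B) := ((IsSelfAdjoint.one _).neg).add h1
    exact h2.isSymmetric
  have hhalf (i : ι) : ((1 / 2 : ℝ) • opM ε A B) (b i) = ((√(1 + c * l i) - 1) / 2) • b i := by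
    rw [FunLike.coe_smul, Pi.smul_apply, hM, smul_smul]
    congr 1
    ring
  have hhsymm : ((1 / 2 : ℝ) • opM ε A B).IsSymmetric := fun x y => by
    simpa [inner_smul_left, inner_smul_right] using hMsymm x y
  have hh0 (i : ι) : 0 ≤ (√(1 + c * l i) - 1) / 2 := by linarith [hm0 i]
  have hhs := hms.div_const 2
  have hlog : Summable fun i => Real.log (1 + (√(1 + c * l i) - 1) / 2) :=
    Summable.of_nonneg_of_le (fun i => Real.log_nonneg (by linarith [hh0 i]))
      (fun i => by
        have := Real.log_le_sub_one_of_pos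
          (show 0 < 1 + (√(1 + c * l i) - 1) / 2 by linarith [hh0 i])
        linarith) hhs
  have hf (i : ι) : entropicFun c (l i)
      = (√(1 + c * l i) - 1) - Real.log (1 + (√(1 + c * l i) - 1) / 2) := by
    rw [entropicFun]
    congr 2
    ring
  rw [entropicWassersteinSq, opTrace_eq_tsum b hM hm0 hms,
    log_fredholmDet_eq_tsum b hhalf hhsymm hh0 hhs, tsum_congr hf, hms.tsum_sub hlog]
  ring

/-- The entropic Wasserstein distance of two operators which are factorized through
Hilbert–Schmidt operators. -/
lemma exists_isSingularSystem_entropicWassersteinSq (E₀ : H₀ →L[ℝ] L) (E₁ : H₁ →L[ℝ] L)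
    (h₀ : HilbertBasis κ₀ ℝ H₀) (h₁ : HilbertBasis κ₁ ℝ H₁)
    (hE₀ : Summable fun j => ‖E₀ (h₀ j)‖ ^ 2) (hE₁ : Summable fun j => ‖E₁ (h₁ j)‖ ^ 2)
    {ε : ℝ} (hε : 0 < ε) :
    ∃ (ι : Type u) (w : ι → H₁), IsSingularSystem (E₀.adjoint ∘L E₁) w ∧
      (Summable fun i => ‖w i‖ ^ 2) ∧
      entropicWassersteinSq ε (E₀ ∘L E₀.adjoint) (E₁ ∘L E₁.adjoint)
        = ∑' j, ‖E₀ (h₀ j)‖ ^ 2 + ∑' j, ‖E₁ (h₁ j)‖ ^ 2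
          - ε / 2 * ∑' i, entropicFun (16 / ε ^ 2) (‖w i‖ ^ 2) := by
  have hpos : (E₀ ∘L E₀.adjoint).IsPositive := E₀.isPositive_self_comp_adjoint
  have hcpt : IsCompactOperator (E₀ ∘L E₀.adjoint) :=
    (isCompactOperator_of_summable h₀ E₀ hE₀).comp_clm E₀.adjoint
  obtain ⟨ι₀, b₀, l₀, hb₀⟩ := exists_eigenbasis _ hcpt hpos.isSymmetric
  have hl₀ (i : ι₀) : 0 ≤ l₀ i := by
    have := hpos.inner_nonneg_left (b₀ i)
    rwa [hb₀, real_inner_smul_left, real_inner_self_eq_norm_sq, b₀.orthonormal.1 i, one_pow,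
      mul_one] at this
  obtain ⟨hR, hRR⟩ := opSqrt_spec (exists_isPositive_sqrt b₀ hb₀ hl₀)
  set R := opSqrt (E₀ ∘L E₀.adjoint) with hRdef
  have hcpt' : IsCompactOperator (R * (E₁ ∘L E₁.adjoint) * R) :=
    (((isCompactOperator_of_summable h₁ E₁ hE₁).comp_clm E₁.adjoint).clm_comp R).comp_clm R
  have hsymm' : (R * (E₁ ∘L E₁.adjoint) * R).IsSymmetric := fun x y => by
    change ⟪R (E₁ (E₁.adjoint (R x))), y⟫_ℝ = ⟪x, R (E₁ (E₁.adjoint (R y)))⟫_ℝ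
    exact (hR.isSymmetric _ _).trans ((E₁.isPositive_self_comp_adjoint.isSymmetric _ _).trans
      (hR.isSymmetric _ _))
  obtain ⟨ι, b, l, hb⟩ := exists_eigenbasis _ hcpt' hsymm'
  obtain ⟨hw, hwl⟩ := isSingularSystem_of_eigenbasis E₀ E₁ hR.isSymmetric hRR b hb
  have hws : Summable fun i => ‖E₁.adjoint (R (b i))‖ ^ 2 := by
    refine summable_norm_sq_of_adjoint (T := E₁.adjoint ∘L R) h₁ b ?_
    refine Summable.of_nonneg_of_le (fun _ => sq_nonneg _) (fun j => ?_)
      (hE₁.mul_left (‖R‖ ^ 2))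
    rw [ContinuousLinearMap.adjoint_comp, ContinuousLinearMap.adjoint_adjoint,
      hR.isSelfAdjoint.adjoint_eq, ← mul_pow]
    gcongr
    exact R.le_opNorm _
  refine ⟨ι, _, hw, hws, ?_⟩
  simp_rw [hwl] at hws ⊢
  rw [entropicWassersteinSq_eq_of_eigenbasis b hb (fun i => hwl i ▸ sq_nonneg _) hws hε,
    opTrace_comp_adjoint h₀ E₀ hE₀, opTrace_comp_adjoint h₁ E₁ hE₁]

end Factorization

/-! ### Uniqueness of the principal matrix square root. -/

section PrincipalSquareRoot

open Polynomial

lemma aeval_mul_of_semiconj {A : Type*} [Ring A] [Algebra ℂ A] {x y z : A} (h : x * z = z * y)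
    (p : ℂ[X]) : aeval x p * z = z * aeval y p := by
  induction p using Polynomial.induction_on' with
  | add p q hp hq => rw [map_add, map_add, add_mul, mul_add, hp, hq]
  | monomial k a =>
    rw [aeval_monomial, aeval_monomial, mul_assoc, ← mul_assoc z, ← Algebra.commutes a z, mul_assoc]
    congr 1
    exact (SemiconjBy.pow_right (show SemiconjBy z y x from h.symm) k).symm

variable {n : Type*} [Fintype n] [DecidableEq n]

/-- Uniqueness of the principal square root of a complex matrix. -/
lemma eq_of_mul_self_eq_of_spectrum_re_pos {X Y : Matrix n n ℂ} (h : X * X = Y * Y)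
    (hX : ∀ z ∈ spectrum ℂ X, 0 < z.re) (hY : ∀ z ∈ spectrum ℂ Y, 0 < z.re) : X = Y := by
  -- Sylvester's argument: `X - Y` intertwines `X` and `-Y`, whose spectra lie in opposite open
  -- half-planes. The characteristic polynomial of `X` kills `X` but is invertible at `-Y`.
  have hsemi : X * (X - Y) = (X - Y) * (-Y) := by
    rw [mul_sub, sub_mul, mul_neg, mul_neg, h]
    abel
  have hp := aeval_mul_of_semiconj hsemi X.charpoly
  rw [Matrix.aeval_self_charpoly, zero_mul] at hp
  have hunit : IsUnit (aeval (-Y) X.charpoly) := by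
    by_contra hnu
    have hsplit := (IsAlgClosed.splits X.charpoly).eq_prod_roots
    rw [X.charpoly_monic.leadingCoeff, C_1, one_mul] at hsplit
    rw [hsplit] at hnu
    obtain ⟨k, hk, hk0⟩ := spectrum.exists_mem_of_not_isUnit_aeval_prod hnu
    have h1 : 0 < k.re := hX k (Matrix.mem_spectrum_iff_isRoot_charpoly.2 hk0)
    have h2 : -k ∈ spectrum ℂ Y := by
      rw [← Set.neg_mem_neg, neg_neg, spectrum.neg_eq]
      exact hk
    have := hY _ h2
    rw [Complex.neg_re] at this
    linarith
  exact sub_eq_zero.1 ((hunit.mul_left_eq_zero).1 hp.symm)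

lemma spectrum_conj_diagonal_subset {V V' : Matrix n n ℂ} (hV : V * V' = 1) (hV' : V' * V = 1)
    (d : n → ℂ) {z : ℂ} (hz : z ∈ spectrum ℂ (V * Matrix.diagonal d * V')) : ∃ i, z = d i := by
  let U : (Matrix n n ℂ)ˣ := ⟨V, V', hV, hV'⟩
  have h : spectrum ℂ (V * Matrix.diagonal d * V') = spectrum ℂ (Matrix.diagonal d) :=
    spectrum.units_conjugate (a := Matrix.diagonal d) (u := U)
  rw [h, spectrum_diagonal] at hz
  obtain ⟨i, hi⟩ := hz
  exact ⟨i, hi.symm⟩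

end PrincipalSquareRoot

/-! ### The estimator's matrix function through a symmetric eigenproblem. -/

section Estimator

open scoped MatrixOrder

variable {n : ℕ}

lemma matSqrt_eq {A B : Matrix (Fin n) (Fin n) ℝ} (hB : B * B = A)
    (hs : ∀ z ∈ spectrum ℂ (B.map (algebraMap ℝ ℂ)), 0 < z.re) : matSqrt A = B := by
  have hex : ∃ B : Matrix (Fin n) (Fin n) ℝ, B * B = A ∧
      ∀ z ∈ spectrum ℂ (B.map (algebraMap ℝ ℂ)), 0 < z.re := ⟨B, hB, hs⟩
  rw [matSqrt, dif_pos hex]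
  obtain ⟨h1, h2⟩ := hex.choose_spec
  refine Matrix.map_injective (algebraMap ℝ ℂ).injective
    (eq_of_mul_self_eq_of_spectrum_re_pos ?_ h2 hs)
  rw [← Matrix.map_mul, ← Matrix.map_mul, h1, hB]

/-- `matF` of a product of two positive semidefinite matrices, in terms of the eigenvalues of
`S₀^{1/2} S₁ S₀^{1/2}`. -/
lemma exists_eigenbasis_matF {S₀ S₁ : Matrix (Fin n) (Fin n) ℝ} (h₀ : S₀.PosSemidef)
    (h₁ : S₁.PosSemidef) {c : ℝ} (hc : 0 ≤ c) :
    ∃ (R : Matrix (Fin n) (Fin n) ℝ) (b : HilbertBasis (Fin n) ℝ (EuclideanSpace ℝ (Fin n)))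
      (l : Fin n → ℝ), R.IsHermitian ∧ R * R = S₀ ∧
        (∀ i, Matrix.toEuclideanCLM (𝕜 := ℝ) (R * S₁ * R) (b i) = l i • b i) ∧
        matF (c • (S₀ * S₁)) = ∑ i, entropicFun c (l i) := by
  set R := CFC.sqrt S₀
  have hR : R.IsHermitian := (Matrix.nonneg_iff_posSemidef.1 (CFC.sqrt_nonneg S₀)).isHermitian
  have hRR : R * R = S₀ := CFC.sqrt_mul_sqrt_self S₀ h₀.nonneg
  have hA : (R * S₁ * R).PosSemidef := by
    have := h₁.mul_mul_conjTranspose_same R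
    rwa [hR.eq] at this
  set l := hA.isHermitian.eigenvalues with hl
  have hl0 (i : Fin n) : 0 ≤ l i := hA.eigenvalues_nonneg i
  refine ⟨R, hA.isHermitian.eigenvectorBasis.toHilbertBasis, l, hR, hRR, fun i => ?_, ?_⟩
  · rw [OrthonormalBasis.coe_toHilbertBasis]
    ext j
    exact congrFun (hA.isHermitian.mulVec_eigenvectorBasis i) j
  set V : Matrix (Fin n) (Fin n) ℝ := hA.isHermitian.eigenvectorUnitary.1
  set V' : Matrix (Fin n) (Fin n) ℝ := star V
  have hVV' : V * V' = 1 := Unitary.coe_mul_star_self _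
  have hV'V : V' * V = 1 := Unitary.coe_star_mul_self _
  set W : (Fin n → ℝ) → Matrix (Fin n) (Fin n) ℝ := fun d => V * Matrix.diagonal d * V' with hW
  have hWmul (d e : Fin n → ℝ) : W d * W e = W (d * e) := by
    calc W d * W e = V * Matrix.diagonal d * (V' * V) * Matrix.diagonal e * V' := by
          simp only [hW, Matrix.mul_assoc]
      _ = W (d * e) := by
          rw [hV'V, Matrix.mul_one, Matrix.mul_assoc V, Matrix.diagonal_mul_diagonal]
          rfl
  have hWadd (d e : Fin n → ℝ) : W d + W e = W (d + e) := by
    simp only [hW]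
    rw [← Matrix.add_mul, ← Matrix.mul_add, Matrix.diagonal_add]
    rfl
  have hWconst (a : ℝ) : W (fun _ => a) = a • 1 := by
    simp only [hW]
    rw [← Matrix.smul_one_eq_diagonal, Matrix.mul_smul, Matrix.smul_mul, Matrix.mul_one, hVV']
  have hAW : R * S₁ * R = W l := by
    conv_lhs => rw [hA.isHermitian.spectral_theorem, Unitary.conjStarAlgAut_apply]
    rfl
  set s : Fin n → ℝ := fun i => √(1 + c * l i) with hs
  have hs1 (i : Fin n) : 1 ≤ s i :=
    Real.one_le_sqrt.2 (by linarith [mul_nonneg hc (hl0 i)])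
  have hs2 (i : Fin n) : s i * s i = 1 + c * l i :=
    Real.mul_self_sqrt (by linarith [mul_nonneg hc (hl0 i)])
  -- The root is sought as `1 + R * Y` with `Y = W η * R * S₁`, which avoids inverting the possibly
  -- singular `R`. Squaring requires `2 η + η² l = c`. The solution `(s - 1) / l` is written as `c /
  -- (1 + s)`, which also covers `l = 0`.
  set η : Fin n → ℝ := fun i => c / (1 + s i) with hη
  have hηl : η * l = s - 1 := by
    ext i
    have := hs1 i
    simp only [hη, Pi.mul_apply, Pi.sub_apply, Pi.one_apply]
    rw [div_mul_eq_mul_div, div_eq_iff (by linarith)]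
    linarith [hs2 i]
  have hηeq : η + η + η * l * η = fun _ => c := by
    ext i
    rw [hηl]
    have : (1 + s i) ≠ 0 := by linarith [hs1 i]
    simp only [hη, Pi.add_apply, Pi.mul_apply, Pi.sub_apply, Pi.one_apply]
    field_simp
    ring
  set Y := W η * R * S₁ with hY
  have hYR : Y * R = W (s - 1) := by
    rw [hY, Matrix.mul_assoc, Matrix.mul_assoc, ← Matrix.mul_assoc R, hAW, hWmul, hηl]
  have hBB : (1 + R * Y) * (1 + R * Y) = 1 + c • (S₀ * S₁) := by
    calc (1 + R * Y) * (1 + R * Y)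
        = 1 + R * (W η + W η + W η * (R * S₁ * R) * W η) * (R * S₁) := by
          rw [hY]
          noncomm_ring
      _ = 1 + c • (S₀ * S₁) := by
          rw [hAW, hWmul, hWmul, hWadd, hWadd, hηeq, hWconst, ← hRR]
          simp [Matrix.mul_assoc]
  -- `R * Y` and `Y * R = W (s - 1)` share their nonzero eigenvalues, so the spectrum of `1 + R * Y`
  -- consists of numbers `s i ≥ 1` and possibly `1`. Trace and determinant below are moved to `Y *
  -- R` in the same way.
  have hspec : ∀ z ∈ spectrum ℂ ((1 + R * Y).map (algebraMap ℝ ℂ)), 0 < z.re := by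
    intro z hz
    have hmap : (1 + R * Y).map (algebraMap ℝ ℂ)
        = algebraMap ℂ _ 1 + R.map (algebraMap ℝ ℂ) * Y.map (algebraMap ℝ ℂ) := by
      rw [← Matrix.map_mul, map_one, Matrix.map_add _ (map_add _)]
      simp
    rw [hmap, ← spectrum.singleton_add_eq, Set.singleton_add] at hz
    obtain ⟨y, hy, rfl⟩ := hz
    by_cases hy0 : y = 0
    · simp [hy0]
    · have h1 : y ∈ spectrum ℂ (Y.map (algebraMap ℝ ℂ) * R.map (algebraMap ℝ ℂ)) \ {0} := by
        rw [spectrum.nonzero_mul_comm]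
        exact ⟨hy, hy0⟩
      have h2 := h1.1
      rw [← Matrix.map_mul, hYR] at h2
      simp only [hW] at h2
      rw [Matrix.map_mul, Matrix.map_mul, Matrix.diagonal_map (map_zero _)] at h2
      obtain ⟨i, hi⟩ := spectrum_conj_diagonal_subset
        (by rw [← Matrix.map_mul, hVV']; simp) (by rw [← Matrix.map_mul, hV'V]; simp) _ h2
      rw [hi]
      simpa using by linarith [hs1 i]
  have htrW (d : Fin n → ℝ) : (W d).trace = ∑ i, d i := by
    simp only [hW]
    rw [Matrix.trace_mul_comm, ← Matrix.mul_assoc, hV'V, Matrix.one_mul, Matrix.trace_diagonal]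
  have hdetW (d : Fin n → ℝ) : (W d).det = ∏ i, d i := by
    simp only [hW]
    rw [Matrix.det_mul_comm, ← Matrix.mul_assoc, hV'V, Matrix.one_mul, Matrix.det_diagonal]
  have htrace : (-1 + (1 + R * Y)).trace = ∑ i, (s i - 1) := by
    rw [neg_add_cancel_left, Matrix.trace_mul_comm, hYR, htrW]
    rfl
  have hdet : ((1 / 2 : ℝ) • (1 : Matrix (Fin n) (Fin n) ℝ) + (1 / 2 : ℝ) • (1 + R * Y)).det
      = ∏ i, ((1 + s i) / 2) := by
    have h1 : (1 / 2 : ℝ) • (1 : Matrix (Fin n) (Fin n) ℝ) + (1 / 2 : ℝ) • (1 + R * Y)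
        = 1 + R * ((1 / 2 : ℝ) • Y) := by
      rw [smul_add, ← add_assoc, ← add_smul, Matrix.mul_smul]
      norm_num
    have h2 : 1 + ((1 / 2 : ℝ) • Y) * R = W (fun i => (1 + s i) / 2) := by
      have h3 : (1 : Matrix (Fin n) (Fin n) ℝ) = W (fun _ => 1) := by rw [hWconst, one_smul]
      have h4 : (1 / 2 : ℝ) • (1 : Matrix (Fin n) (Fin n) ℝ) = W (fun _ => 1 / 2) :=
        (hWconst _).symm
      rw [Matrix.smul_mul, hYR, ← Matrix.one_mul (W (s - 1)), ← Matrix.smul_mul, h4, hWmul, h3,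
        hWadd]
      congr 1
      ext i
      simp only [Pi.add_apply, Pi.mul_apply, Pi.sub_apply, Pi.one_apply]
      ring
    rw [h1, Matrix.det_one_add_mul_comm, h2, hdetW]
  rw [matF, matSqrt_eq hBB hspec, htrace, hdet,
    Real.log_prod (fun i _ => by linarith [hs1 i]), ← Finset.sum_sub_distrib]
  rfl

end Estimator

/-! ### Feature maps of kernels. -/

section Feature

/-- `‖φ y - φ x‖²` expands into inner products, which tend to `0` as `y → x`. -/
lemma continuous_of_continuous_inner {X H : Type*} [TopologicalSpace X] [NormedAddCommGroup H]
    [InnerProductSpace ℝ H] {φ : X → H} (h : Continuous fun p : X × X => ⟪φ p.1, φ p.2⟫_ℝ) :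
    Continuous φ := by
  refine continuous_iff_continuousAt.2 fun x => ?_
  rw [ContinuousAt, tendsto_iff_norm_sub_tendsto_zero]
  have hsq : Continuous fun y => √(⟪φ y, φ y⟫_ℝ - 2 * ⟪φ y, φ x⟫_ℝ + ⟪φ x, φ x⟫_ℝ) := by
    have h1 : Continuous fun y => ⟪φ y, φ y⟫_ℝ := h.comp (continuous_id.prodMk continuous_id)
    have h2 : Continuous fun y => ⟪φ y, φ x⟫_ℝ := h.comp (continuous_id.prodMk continuous_const)
    fun_prop
  have := hsq.tendsto x
  convert this using 2 with y
  · rw [real_inner_self_eq_norm_sq, real_inner_self_eq_norm_sq, ← norm_sub_sq_real,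
      Real.sqrt_sq (norm_nonneg _)]
  · rw [show ⟪φ x, φ x⟫_ℝ - 2 * ⟪φ x, φ x⟫_ℝ + ⟪φ x, φ x⟫_ℝ = 0 by ring, Real.sqrt_zero]

variable {𝒳 : Type u} [TopologicalSpace 𝒳]

/-- A covariance kernel has a continuous feature map into a Hilbert space. -/
lemma exists_feature (K : C(𝒳 × 𝒳, ℝ)) (hK : IsCovarianceKernel K) :
    ∃ (H : Type u) (_ : NormedAddCommGroup H) (_ : InnerProductSpace ℝ H) (_ : CompleteSpace H)
      (φ : C(𝒳, H)), ∀ x y, ⟪φ x, φ y⟫_ℝ = K (x, y) := by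
  -- The RKHS is built from an operator-valued kernel; here each scalar acts on `ℝ` by
  -- multiplication.
  let M : Matrix 𝒳 𝒳 (ℝ →L[ℝ] ℝ) := Matrix.of fun x y => K (x, y) • 1
  have hM : M.PosSemidef := by
    have htfae := (RKHS.posSemidef_tfae (K := M)).out 0 2
    refine htfae.2 ⟨?_, fun v => ?_⟩
    · refine Matrix.IsHermitian.ext fun x y => ?_
      have h1 : K (y, x) = K (x, y) := by simpa using hK.isHermitian.apply x y
      simp [M, h1]
    · have h1 := hK.2 v
      rw [Finsupp.sum_comm]
      simpa [M, mul_comm, mul_left_comm] using h1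
  have : Fact M.PosSemidef := ⟨hM⟩
  let φ : 𝒳 → RKHS.OfKernel M := fun x => RKHS.kerFun (RKHS.OfKernel M) x 1
  have hφ (x y : 𝒳) : ⟪φ x, φ y⟫_ℝ = K (x, y) := by
    simp only [φ]
    rw [RKHS.kerFun_inner, RKHS.kerFun_apply, RKHS.OfKernel.kernel_ofKernel]
    simp [M]
  have hcont : Continuous φ := continuous_of_continuous_inner (by simpa only [hφ] using K.continuous)
  exact ⟨RKHS.OfKernel M, inferInstance, inferInstance, inferInstance, ⟨φ, hcont⟩, hφ⟩

end Feature

/-! ### Feature operators into `L²(ρ)` and Mercer's trace formula. -/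

section FeatureOperators

variable {𝒳 : Type u} [TopologicalSpace 𝒳] [CompactSpace 𝒳]
variable {H : Type*} [NormedAddCommGroup H] [InnerProductSpace ℝ H]
variable {H₁ : Type*} [NormedAddCommGroup H₁] [InnerProductSpace ℝ H₁]

/-- The map `h ↦ ⟪φ(·), h⟫` into the continuous functions. -/
noncomputable def featureEval (φ : C(𝒳, H)) : H →L[ℝ] C(𝒳, ℝ) :=
  LinearMap.mkContinuous
    { toFun := fun h => ⟨fun x => ⟪φ x, h⟫_ℝ, by fun_prop⟩
      map_add' := fun h k => by
        ext x
        exact inner_add_right _ _ _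
      map_smul' := fun c h => by
        ext x
        exact real_inner_smul_right _ _ _ } ‖φ‖
    (fun h => (ContinuousMap.norm_le _ (by positivity)).2 fun x =>
      (norm_inner_le_norm _ _).trans (by gcongr; exact φ.norm_coe_le_norm x))

@[simp]
lemma featureEval_apply (φ : C(𝒳, H)) (h : H) (x : 𝒳) : featureEval φ h x = ⟪φ x, h⟫_ℝ := rfl

variable [MeasurableSpace 𝒳] [BorelSpace 𝒳] (ρ : Measure 𝒳) [IsProbabilityMeasure ρ]

/-- The map `h ↦ ⟪φ(·), h⟫` into `L²(ρ)`. -/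
noncomputable def featureL2 (φ : C(𝒳, H)) : H →L[ℝ] Lp ℝ 2 ρ :=
  (ContinuousMap.toLp 2 ρ ℝ).comp (featureEval φ)

lemma inner_featureL2 (φ : C(𝒳, H)) (ψ : C(𝒳, H₁)) (h : H) (k : H₁) :
    ⟪featureL2 ρ φ h, featureL2 ρ ψ k⟫_ℝ = ∫ x, ⟪φ x, h⟫_ℝ * ⟪ψ x, k⟫_ℝ ∂ρ := by
  rw [featureL2, featureL2, ContinuousLinearMap.comp_apply, ContinuousLinearMap.comp_apply,
    ContinuousMap.inner_toLp]
  simp [mul_comm]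

/-- At `x`, the right side is `⟪φ x, E† f⟫ = ⟪E (φ x), f⟫`, and `E (φ x)` is the kernel section `K
(x, ·)`. -/
lemma covarianceOperator_eq_comp_adjoint [CompleteSpace H] {K : C(𝒳 × 𝒳, ℝ)} {φ : C(𝒳, H)}
    (hφ : ∀ x y, ⟪φ x, φ y⟫_ℝ = K (x, y)) :
    covarianceOperator ρ K = featureL2 ρ φ ∘L (featureL2 ρ φ).adjoint := by
  ext1 f
  rw [ContinuousLinearMap.comp_apply]
  change ContinuousMap.toLp 2 ρ ℝ (kernelIntegral ρ K f)
    = ContinuousMap.toLp 2 ρ ℝ (featureEval φ ((featureL2 ρ φ).adjoint f))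
  congr 1
  ext x
  rw [featureEval_apply, ContinuousLinearMap.adjoint_inner_right]
  change ∫ s, K (x, s) * f s ∂ρ = _
  rw [integral_kernel_eq_inner]
  have hcurry : K.curry x = featureEval φ (φ x) := by
    ext y
    rw [featureEval_apply, real_inner_comm, hφ]
    rfl
  rw [hcurry]
  rfl

lemma integrable_of_continuous {F : Type*} [NormedAddCommGroup F] {f : 𝒳 → F}
    (hf : Continuous f) : Integrable f ρ :=
  hf.integrable_of_hasCompactSupport (HasCompactSupport.of_compactSpace f)

/-- The squared Hilbert–Schmidt norm of `featureL2`: Mercer's trace formula. -/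
lemma hasSum_norm_sq_featureL2 {ι : Type*} (b : HilbertBasis ι ℝ H) (φ : C(𝒳, H)) :
    HasSum (fun i => ‖featureL2 ρ φ (b i)‖ ^ 2) (∫ x, ‖φ x‖ ^ 2 ∂ρ) := by
  have hnorm (i : ι) : ‖featureL2 ρ φ (b i)‖ ^ 2 = ∫ x, ⟪φ x, b i⟫_ℝ ^ 2 ∂ρ := by
    rw [← real_inner_self_eq_norm_sq, inner_featureL2]
    simp_rw [sq]
  simp_rw [hnorm]
  set F : Finset ι → 𝒳 → ℝ := fun s x => ∑ i ∈ s, ⟪φ x, b i⟫_ℝ ^ 2 with hF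
  have hFc (s : Finset ι) : Continuous (F s) := by fun_prop
  have hfc : Continuous fun x => ‖φ x‖ ^ 2 := by fun_prop
  -- Dini's theorem: the partial sums are continuous and increase to a continuous limit on a compact
  -- space. It works along the net of finite sets, so `ι` may be uncountable.
  have hunif : TendstoUniformly F (fun x => ‖φ x‖ ^ 2) Filter.atTop := by
    refine Monotone.tendstoUniformly_of_forall_tendsto hFc (fun s t hst x => ?_) hfc fun x => ?_
    · exact Finset.sum_le_sum_of_subset_of_nonneg hst fun _ _ _ => sq_nonneg _
    · have := hasSum_inner_sq b (φ x)
      simp_rw [real_inner_comm (φ x)] at this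
      exact this
  rw [HasSum, SummationFilter.unconditional_filter, Metric.tendsto_nhds]
  intro δ hδ
  filter_upwards [Metric.tendstoUniformly_iff.1 hunif (δ / 2) (by positivity)] with s hs
  rw [← integral_finsetSum s fun i _ => integrable_of_continuous ρ (by fun_prop), dist_comm,
    Real.dist_eq, ← integral_sub (integrable_of_continuous ρ hfc)
      (integrable_of_continuous ρ (hFc s))]
  have h1 := norm_integral_le_of_norm_le_const (μ := ρ) (f := fun x => ‖φ x‖ ^ 2 - F s x)
    (C := δ / 2) (Filter.Eventually.of_forall fun x => by
      have := (hs x).le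
      rwa [Real.dist_eq] at this)
  rw [probReal_univ, mul_one, Real.norm_eq_abs] at h1
  linarith

end FeatureOperators

/-! ### Feature operators of the empirical measure. -/

section Empirical

variable {𝒳 : Type u} [TopologicalSpace 𝒳]
variable {H : Type*} [NormedAddCommGroup H] [InnerProductSpace ℝ H]
variable {H₁ : Type*} [NormedAddCommGroup H₁] [InnerProductSpace ℝ H₁]
variable {n : ℕ}

/-- The map `h ↦ (n^{-1/2} ⟪φ(xₖ), h⟫)ₖ`. -/
noncomputable def featureEmp (φ : C(𝒳, H)) (x : Fin n → 𝒳) : H →L[ℝ] EuclideanSpace ℝ (Fin n) :=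
  (EuclideanSpace.equiv (Fin n) ℝ).symm.toContinuousLinearMap ∘L
    ContinuousLinearMap.pi fun k => (√(n : ℝ))⁻¹ • innerSL ℝ (φ (x k))

@[simp]
lemma featureEmp_apply (φ : C(𝒳, H)) (x : Fin n → 𝒳) (h : H) (k : Fin n) :
    featureEmp φ x h k = (√(n : ℝ))⁻¹ * ⟪φ (x k), h⟫_ℝ := rfl

lemma inner_featureEmp (φ : C(𝒳, H)) (ψ : C(𝒳, H₁)) (x : Fin n → 𝒳) (h : H) (k : H₁) :
    ⟪featureEmp φ x h, featureEmp ψ x k⟫_ℝ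
      = (n : ℝ)⁻¹ * ∑ j, ⟪φ (x j), h⟫_ℝ * ⟪ψ (x j), k⟫_ℝ := by
  rw [PiLp.inner_apply, Finset.mul_sum]
  refine Finset.sum_congr rfl fun j _ => ?_
  have hn : (√(n : ℝ))⁻¹ * (√(n : ℝ))⁻¹ = (n : ℝ)⁻¹ := by
    rw [← mul_inv, Real.mul_self_sqrt (Nat.cast_nonneg n)]
  rw [featureEmp_apply, featureEmp_apply, ← hn]
  simp only [RCLike.inner_apply, conj_trivial]
  ring

lemma toEuclideanCLM_empiricalCov [CompleteSpace H] {K : C(𝒳 × 𝒳, ℝ)} {φ : C(𝒳, H)}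
    (hφ : ∀ x y, ⟪φ x, φ y⟫_ℝ = K (x, y)) (x : Fin n → 𝒳) :
    Matrix.toEuclideanCLM (𝕜 := ℝ) (empiricalCov K x)
      = featureEmp φ x ∘L (featureEmp φ x).adjoint := by
  ext a k
  rw [ContinuousLinearMap.comp_apply, featureEmp_apply, ContinuousLinearMap.adjoint_inner_right,
    PiLp.inner_apply, Finset.mul_sum]
  change (Matrix.mulVec (empiricalCov K x) a) k = _
  rw [Matrix.mulVec, dotProduct]
  refine Finset.sum_congr rfl fun j _ => ?_
  have hn : (√(n : ℝ))⁻¹ * (√(n : ℝ))⁻¹ = 1 / (n : ℝ) := by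
    rw [← mul_inv, Real.mul_self_sqrt (Nat.cast_nonneg n), one_div]
  rw [featureEmp_apply, real_inner_comm (φ (x k)), hφ, empiricalCov, Matrix.of_apply, ← hn]
  simp only [RCLike.inner_apply, conj_trivial]
  ring

lemma posSemidef_empiricalCov {K : C(𝒳 × 𝒳, ℝ)} (hK : IsCovarianceKernel K) (x : Fin n → 𝒳) :
    (empiricalCov K x).PosSemidef := by
  have h := (Matrix.PosSemidef.submatrix hK x).smul (show (0 : ℝ) ≤ 1 / n by positivity)
  exact h

end Empirical

/-! ### The tensor product feature map. -/

section TensorFeature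

variable {𝒳 : Type u} [TopologicalSpace 𝒳]
variable {H₀ : Type*} [NormedAddCommGroup H₀] [InnerProductSpace ℝ H₀]
variable {H₁ : Type*} [NormedAddCommGroup H₁] [InnerProductSpace ℝ H₁]
variable {ι : Type*}

lemma hasSum_lp_norm_sq (u : lp (fun _ : ι => H₁) 2) :
    HasSum (fun i => ‖u i‖ ^ 2) (‖u‖ ^ 2) := by
  have h := lp.hasSum_inner (𝕜 := ℝ) u u
  simp_rw [real_inner_self_eq_norm_sq] at h
  exact h

lemma memℓp_inner_smul (b : HilbertBasis ι ℝ H₀) (h : H₀) (k : H₁) :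
    Memℓp (fun i => ⟪h, b i⟫_ℝ • k) 2 := by
  refine memℓp_gen ?_
  simp only [norm_smul, ENNReal.toReal_ofNat, Real.rpow_ofNat, mul_pow, Real.norm_eq_abs, sq_abs]
  simp_rw [real_inner_comm _ h]
  exact (hasSum_inner_sq b h).summable.mul_right _

/-- The tensor product `φ₀ ⊗ φ₁` of two feature maps, in coordinates with respect to a Hilbert basis
of the first feature space. -/
noncomputable def tensorFeature (b : HilbertBasis ι ℝ H₀) (φ₀ : C(𝒳, H₀)) (φ₁ : C(𝒳, H₁)) :
    C(𝒳, lp (fun _ : ι => H₁) 2) where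
  toFun x := ⟨fun i => ⟪φ₀ x, b i⟫_ℝ • φ₁ x, memℓp_inner_smul b _ _⟩
  continuous_toFun := by
    refine continuous_of_continuous_inner ?_
    have h (x y : 𝒳) : ⟪(⟨fun i => ⟪φ₀ x, b i⟫_ℝ • φ₁ x, memℓp_inner_smul b _ _⟩ :
        lp (fun _ : ι => H₁) 2), ⟨fun i => ⟪φ₀ y, b i⟫_ℝ • φ₁ y, memℓp_inner_smul b _ _⟩⟫_ℝ
          = ⟪φ₀ x, φ₀ y⟫_ℝ * ⟪φ₁ x, φ₁ y⟫_ℝ := by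
      refine (lp.hasSum_inner (𝕜 := ℝ) _ _).unique ?_
      refine ((b.hasSum_inner_mul_inner (φ₀ x) (φ₀ y)).mul_right _).congr_fun fun i => ?_
      rw [real_inner_smul_left, real_inner_smul_right, real_inner_comm (b i) (φ₀ y)]
      ring
    simp_rw [h]
    fun_prop

lemma tensorFeature_apply (b : HilbertBasis ι ℝ H₀) (φ₀ : C(𝒳, H₀)) (φ₁ : C(𝒳, H₁)) (x : 𝒳)
    (i : ι) : tensorFeature b φ₀ φ₁ x i = ⟪φ₀ x, b i⟫_ℝ • φ₁ x := rfl

lemma norm_tensorFeature_sq (b : HilbertBasis ι ℝ H₀) (φ₀ : C(𝒳, H₀)) (φ₁ : C(𝒳, H₁)) (x : 𝒳) :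
    ‖tensorFeature b φ₀ φ₁ x‖ ^ 2 = ‖φ₀ x‖ ^ 2 * ‖φ₁ x‖ ^ 2 := by
  refine (hasSum_lp_norm_sq _).unique ?_
  refine ((hasSum_inner_sq b (φ₀ x)).mul_right _).congr_fun fun i => ?_
  rw [tensorFeature_apply, norm_smul, mul_pow, Real.norm_eq_abs, sq_abs, real_inner_comm]

end TensorFeature

/-! ### Both values as functions of the mean of the tensor feature. -/

section EntropicValue

variable {H₀ : Type*} [NormedAddCommGroup H₀] [InnerProductSpace ℝ H₀] [CompleteSpace H₀]
variable {H₁ : Type u} [NormedAddCommGroup H₁] [InnerProductSpace ℝ H₁] [CompleteSpace H₁]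
variable {ι : Type*}

/-- `v` is the sum of `entropicFun c` over the squared singular values of the Hilbert–Schmidt
operator whose adjoint maps the Hilbert basis `b` to `u`. -/
def HasEntropicSum (b : HilbertBasis ι ℝ H₀) (c : ℝ) (u : lp (fun _ : ι => H₁) 2) (s : ℝ) : Prop :=
  ∃ (κ : Type v) (C : H₁ →L[ℝ] H₀) (w : κ → H₁), (∀ i, C.adjoint (b i) = u i) ∧
    IsSingularSystem C w ∧ (Summable fun j => ‖w j‖ ^ 2) ∧ s = ∑' j, entropicFun c (‖w j‖ ^ 2)

lemma HasEntropicSum.abs_sub_le {b : HilbertBasis ι ℝ H₀} {c : ℝ} (hc : 0 ≤ c)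
    {u u' : lp (fun _ : ι => H₁) 2} {s s' : ℝ} (h : HasEntropicSum b c u s)
    (h' : HasEntropicSum b c u' s') : |s - s'| ≤ c / 4 * (‖u - u'‖ * ‖u + u'‖) := by
  obtain ⟨κ, C, w, hC, hw, hs, rfl⟩ := h
  obtain ⟨κ', C', w', hC', hw', hs', rfl⟩ := h'
  refine hw.abs_tsum_entropicFun_sub_le hw' hs hs' hc b (norm_nonneg _) (norm_nonneg _) ?_ ?_
  · refine (hasSum_lp_norm_sq (u - u')).congr_fun fun i => ?_
    rw [map_sub, sub_apply, hC, hC']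
    rfl
  · refine (hasSum_lp_norm_sq (u + u')).congr_fun fun i => ?_
    rw [map_add, add_apply, hC, hC']
    rfl

variable {𝒳 : Type v} [TopologicalSpace 𝒳]

/-- For `C = E₀† E₁`, the vector `C† (b i) = E₁† (E₀ (b i))` is the integral of `⟪φ₀ x, b i⟫ • φ₁
x`, the `i`-th coordinate of the mean of the tensor feature. -/
lemma exists_hasEntropicSum_covarianceOperator [CompactSpace 𝒳] [MeasurableSpace 𝒳]
    [BorelSpace 𝒳] (ρ : Measure 𝒳) [IsProbabilityMeasure ρ] {K₀ K₁ : C(𝒳 × 𝒳, ℝ)}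
    {φ₀ : C(𝒳, H₀)} {φ₁ : C(𝒳, H₁)} (h₀ : ∀ x y, ⟪φ₀ x, φ₀ y⟫_ℝ = K₀ (x, y))
    (h₁ : ∀ x y, ⟪φ₁ x, φ₁ y⟫_ℝ = K₁ (x, y)) (b : HilbertBasis ι ℝ H₀) {ε : ℝ} (hε : 0 < ε) :
    ∃ s, HasEntropicSum.{u, v} b (16 / ε ^ 2) (∫ x, tensorFeature b φ₀ φ₁ x ∂ρ) s ∧
      entropicWassersteinSq ε (covarianceOperator ρ K₀) (covarianceOperator ρ K₁)
        = ∫ x, K₀ (x, x) ∂ρ + ∫ x, K₁ (x, x) ∂ρ - ε / 2 * s := by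
  obtain ⟨_, b₁, -⟩ := exists_hilbertBasis ℝ H₁
  have hs₀ := hasSum_norm_sq_featureL2 ρ b φ₀
  have hs₁ := hasSum_norm_sq_featureL2 ρ b₁ φ₁
  obtain ⟨κ, w, hw, hws, hval⟩ := exists_isSingularSystem_entropicWassersteinSq (featureL2 ρ φ₀)
    (featureL2 ρ φ₁) b b₁ hs₀.summable hs₁.summable hε
  refine ⟨_, ⟨κ, _, w, fun i => ?_, hw, hws, rfl⟩, ?_⟩
  · classical
    refine ext_inner_right ℝ fun g => ?_
    rw [ContinuousLinearMap.adjoint_comp, ContinuousLinearMap.adjoint_adjoint,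
      ContinuousLinearMap.comp_apply, ContinuousLinearMap.adjoint_inner_left, inner_featureL2,
      ← lp.inner_single_right, real_inner_comm,
      ← integral_inner (integrable_of_continuous ρ (tensorFeature b φ₀ φ₁).continuous)]
    refine integral_congr_ae (Filter.Eventually.of_forall fun x => ?_)
    simp only
    rw [lp.inner_single_left, tensorFeature_apply, real_inner_smul_right, real_inner_comm g]
  · rw [covarianceOperator_eq_comp_adjoint ρ h₀, covarianceOperator_eq_comp_adjoint ρ h₁, hval,
      hs₀.tsum_eq, hs₁.tsum_eq]
    simp_rw [← h₀, ← h₁, real_inner_self_eq_norm_sq]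

/-- The empirical counterpart, with the sample average of the same tensor feature; this shared
target space makes the two sums comparable. -/
lemma exists_hasEntropicSum_estimator {n : ℕ} {K₀ K₁ : C(𝒳 × 𝒳, ℝ)}
    (hK₀ : IsCovarianceKernel K₀) (hK₁ : IsCovarianceKernel K₁)
    {φ₀ : C(𝒳, H₀)} {φ₁ : C(𝒳, H₁)} (h₀ : ∀ x y, ⟪φ₀ x, φ₀ y⟫_ℝ = K₀ (x, y))
    (h₁ : ∀ x y, ⟪φ₁ x, φ₁ y⟫_ℝ = K₁ (x, y)) (b : HilbertBasis ι ℝ H₀) {ε : ℝ} (hε : 0 < ε)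
    (x : Fin n → 𝒳) :
    ∃ s, HasEntropicSum.{u, 0} b (16 / ε ^ 2)
        ((n : ℝ)⁻¹ • ∑ k, tensorFeature b φ₀ φ₁ (x k)) s ∧
      entropicWassersteinSqEstimator ε K₀ K₁ x
        = (n : ℝ)⁻¹ • ∑ k, K₀ (x k, x k) + (n : ℝ)⁻¹ • ∑ k, K₁ (x k, x k) - ε / 2 * s := by
  obtain ⟨R, e, l, hR, hRR, he, hval⟩ := exists_eigenbasis_matF (posSemidef_empiricalCov hK₀ x)
    (posSemidef_empiricalCov hK₁ x) (show 0 ≤ 16 / ε ^ 2 by positivity)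
  have hRs : (Matrix.toEuclideanCLM (𝕜 := ℝ) R).IsSymmetric := by
    have : IsSelfAdjoint (Matrix.toEuclideanCLM (𝕜 := ℝ) R) :=
      IsSelfAdjoint.map (show IsSelfAdjoint R from hR) _
    exact this.isSymmetric
  obtain ⟨hw, hwl⟩ := isSingularSystem_of_eigenbasis (featureEmp φ₀ x) (featureEmp φ₁ x) hRs
    (by rw [← toEuclideanCLM_empiricalCov h₀, ← hRR, map_mul]; rfl) e (l := l) fun i => by
      rw [← he, map_mul, map_mul, toEuclideanCLM_empiricalCov h₁]
      rfl
  refine ⟨_, ⟨Fin n, _, _, fun i => ?_, hw, summable_of_hasFiniteSupport (Set.toFinite _), rfl⟩, ?_⟩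
  · refine ext_inner_right ℝ fun g => ?_
    rw [ContinuousLinearMap.adjoint_comp, ContinuousLinearMap.adjoint_adjoint,
      ContinuousLinearMap.comp_apply, ContinuousLinearMap.adjoint_inner_left, inner_featureEmp]
    have hcoord : ((n : ℝ)⁻¹ • ∑ k, tensorFeature b φ₀ φ₁ (x k) : lp (fun _ : ι => H₁) 2) i
        = (n : ℝ)⁻¹ • ∑ k, ⟪φ₀ (x k), b i⟫_ℝ • φ₁ (x k) := by
      change (n : ℝ)⁻¹ • ((∑ k, tensorFeature b φ₀ φ₁ (x k) : lp (fun _ : ι => H₁) 2) i) = _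
      rw [lp.coeFn_sum]
      exact congrArg _ (Finset.sum_apply _ _ _)
    simp [hcoord, real_inner_smul_left, sum_inner]
  · simp_rw [hwl]
    rw [tsum_fintype, ← hval, entropicWassersteinSqEstimator, Matrix.trace_add]
    simp [Matrix.trace, empiricalCov, Finset.mul_sum]

end EntropicValue

/-! ### Monte Carlo error in a Hilbert space. -/

section MonteCarlo

variable {𝒳 : Type*} [TopologicalSpace 𝒳] [CompactSpace 𝒳] [MeasurableSpace 𝒳] [BorelSpace 𝒳]
  [SecondCountableTopology 𝒳]
variable {F : Type*} [NormedAddCommGroup F] [InnerProductSpace ℝ F] [CompleteSpace F]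
variable {Ω : Type*} [MeasurableSpace Ω]

lemma integrable_comp_of_continuous {P : Measure Ω} [IsProbabilityMeasure P] {G : Type*}
    [NormedAddCommGroup G] {Y : Type*} [TopologicalSpace Y] [CompactSpace Y] [MeasurableSpace Y]
    [BorelSpace Y] {y : Ω → Y} (hy : AEMeasurable y P) {g : Y → G} (hg : Continuous g) :
    Integrable (fun ω => g (y ω)) P := by
  have := Measure.isProbabilityMeasure_map hy
  exact (integrable_of_continuous (P.map y) hg).comp_aemeasurable hy

/-- The mean square error of the empirical mean of a bounded vector-valued function. -/
lemma integral_norm_sq_sub_mean_le (ρ : Measure 𝒳) [IsProbabilityMeasure ρ] {n : ℕ} (hn : 0 < n)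
    (P : Measure Ω) [IsProbabilityMeasure P] {x : Fin n → Ω → 𝒳} (hlaw : ∀ i, HasLaw (x i) ρ P)
    (hindep : iIndepFun x P) (Φ : C(𝒳, F)) {B : ℝ} (hB : ∀ y, ‖Φ y‖ ≤ B) :
    ∫ ω, ‖∫ y, Φ y ∂ρ - (n : ℝ)⁻¹ • ∑ k, Φ (x k ω)‖ ^ 2 ∂P ≤ B ^ 2 / n := by
  set m := ∫ y, Φ y ∂ρ with hm
  have hΦ : Integrable Φ ρ := integrable_of_continuous ρ Φ.continuous
  have hnR : (n : ℝ) ≠ 0 := by positivity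
  -- The squared error is an average over `n²` pairs. Off-diagonal pairs vanish by independence and
  -- centring; each of the `n` diagonal ones is a variance, at most `B²`.
  have hpair (k l : Fin n) : ∫ ω, ⟪m - Φ (x k ω), m - Φ (x l ω)⟫_ℝ ∂P
      ≤ if k = l then B ^ 2 else 0 := by
    split_ifs with hkl
    · subst hkl
      have h1 : ∫ ω, ⟪m - Φ (x k ω), m - Φ (x k ω)⟫_ℝ ∂P = ∫ y, ⟪m - Φ y, m - Φ y⟫_ℝ ∂ρ :=
        (hlaw k).integral_comp (f := fun y => ⟪m - Φ y, m - Φ y⟫_ℝ)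
          (integrable_of_continuous ρ (by fun_prop)).aestronglyMeasurable
      have h2 (y : 𝒳) : ⟪m - Φ y, m - Φ y⟫_ℝ = ‖m‖ ^ 2 - 2 * ⟪m, Φ y⟫_ℝ + ‖Φ y‖ ^ 2 := by
        rw [real_inner_self_eq_norm_sq, norm_sub_sq_real]
      rw [h1]
      simp_rw [h2]
      rw [integral_add (integrable_of_continuous ρ (by fun_prop))
        (integrable_of_continuous ρ (by fun_prop)), integral_sub (integrable_const _)
        (integrable_of_continuous ρ (by fun_prop)), integral_const_mul, integral_inner hΦ,
        ← hm, real_inner_self_eq_norm_sq]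
      have h3 : ∫ y, ‖Φ y‖ ^ 2 ∂ρ ≤ B ^ 2 := by
        calc ∫ y, ‖Φ y‖ ^ 2 ∂ρ ≤ ∫ _, B ^ 2 ∂ρ :=
              integral_mono (integrable_of_continuous ρ (by fun_prop)) (integrable_const _)
                fun y => pow_le_pow_left₀ (norm_nonneg _) (hB y) 2
          _ = B ^ 2 := by simp
      simp only [integral_const, probReal_univ, smul_eq_mul, one_mul]
      nlinarith [sq_nonneg ‖m‖]
    · have hI := hindep.indepFun hkl
      have hlaw2 := (indepFun_iff_map_prod_eq_prod_map_map (hlaw k).aemeasurable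
        (hlaw l).aemeasurable).1 hI
      rw [(hlaw k).map_eq, (hlaw l).map_eq] at hlaw2
      have hc : Continuous fun p : 𝒳 × 𝒳 => ⟪m - Φ p.1, m - Φ p.2⟫_ℝ := by fun_prop
      have h1 : ∫ ω, ⟪m - Φ (x k ω), m - Φ (x l ω)⟫_ℝ ∂P
          = ∫ p, ⟪m - Φ p.1, m - Φ p.2⟫_ℝ ∂(ρ.prod ρ) := by
        rw [← hlaw2, integral_map ((hlaw k).aemeasurable.prodMk (hlaw l).aemeasurable)
          hc.aestronglyMeasurable]
      rw [h1, integral_prod _ (integrable_of_continuous _ hc)]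
      have h2 (y : 𝒳) : ∫ z, ⟪m - Φ y, m - Φ z⟫_ℝ ∂ρ = 0 := by
        rw [integral_inner (integrable_of_continuous ρ (by fun_prop)),
          integral_sub (integrable_const _) hΦ, ← hm]
        simp
      simp [h2]
  have hexp (ω : Ω) : ‖m - (n : ℝ)⁻¹ • ∑ k, Φ (x k ω)‖ ^ 2
      = ((n : ℝ) ^ 2)⁻¹ * ∑ k, ∑ l, ⟪m - Φ (x k ω), m - Φ (x l ω)⟫_ℝ := by
    have h1 : m - (n : ℝ)⁻¹ • ∑ k, Φ (x k ω) = (n : ℝ)⁻¹ • ∑ k, (m - Φ (x k ω)) := by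
      rw [Finset.sum_sub_distrib, smul_sub, Finset.sum_const, Finset.card_univ, Fintype.card_fin,
        ← Nat.cast_smul_eq_nsmul ℝ, smul_smul, inv_mul_cancel₀ hnR, one_smul]
    rw [h1, norm_smul, mul_pow, ← real_inner_self_eq_norm_sq (∑ k, _), sum_inner]
    simp_rw [inner_sum]
    simp
  have hint (k l : Fin n) : Integrable (fun ω => ⟪m - Φ (x k ω), m - Φ (x l ω)⟫_ℝ) P :=
    integrable_comp_of_continuous (Y := 𝒳 × 𝒳) (y := fun ω => (x k ω, x l ω))
      (g := fun p => ⟪m - Φ p.1, m - Φ p.2⟫_ℝ)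
      ((hlaw k).aemeasurable.prodMk (hlaw l).aemeasurable) (by fun_prop)
  simp_rw [hexp]
  rw [integral_const_mul, integral_finsetSum _ fun k _ => integrable_finsetSum _ fun l _ => hint k l]
  simp_rw [integral_finsetSum _ fun l _ => hint _ l]
  calc ((n : ℝ) ^ 2)⁻¹ * ∑ k, ∑ l, ∫ ω, ⟪m - Φ (x k ω), m - Φ (x l ω)⟫_ℝ ∂P
      ≤ ((n : ℝ) ^ 2)⁻¹ * ∑ k : Fin n, ∑ l : Fin n, if k = l then B ^ 2 else 0 := by
        gcongr with k _ l _
        exact hpair k l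
    _ = B ^ 2 / n := by
        simp only [Finset.sum_ite_eq, Finset.mem_univ, if_true, Finset.sum_const,
          Finset.card_univ, Fintype.card_fin, nsmul_eq_mul]
        field_simp

/-- The mean error of the empirical mean of a bounded vector-valued function. -/
lemma integral_norm_sub_mean_le (ρ : Measure 𝒳) [IsProbabilityMeasure ρ] {n : ℕ} (hn : 0 < n)
    (P : Measure Ω) [IsProbabilityMeasure P] {x : Fin n → Ω → 𝒳} (hlaw : ∀ i, HasLaw (x i) ρ P)
    (hindep : iIndepFun x P) (Φ : C(𝒳, F)) {B : ℝ} (hB : ∀ y, ‖Φ y‖ ≤ B) :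
    Integrable (fun ω => ‖∫ y, Φ y ∂ρ - (n : ℝ)⁻¹ • ∑ k, Φ (x k ω)‖) P ∧
      ∫ ω, ‖∫ y, Φ y ∂ρ - (n : ℝ)⁻¹ • ∑ k, Φ (x k ω)‖ ∂P ≤ B / √(n : ℝ) := by
  have hmeas : AEMeasurable (fun ω k => x k ω) P :=
    aemeasurable_pi_lambda _ fun k => (hlaw k).aemeasurable
  have hint : Integrable (fun ω => ‖∫ y, Φ y ∂ρ - (n : ℝ)⁻¹ • ∑ k, Φ (x k ω)‖) P :=
    integrable_comp_of_continuous hmeas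
      (g := fun z : Fin n → 𝒳 => ‖∫ y, Φ y ∂ρ - (n : ℝ)⁻¹ • ∑ k, Φ (z k)‖) (by fun_prop)
  have hint2 : Integrable (fun ω => ‖∫ y, Φ y ∂ρ - (n : ℝ)⁻¹ • ∑ k, Φ (x k ω)‖ ^ 2) P :=
    integrable_comp_of_continuous hmeas
      (g := fun z : Fin n → 𝒳 => ‖∫ y, Φ y ∂ρ - (n : ℝ)⁻¹ • ∑ k, Φ (z k)‖ ^ 2) (by fun_prop)
  refine ⟨hint, ?_⟩
  have hB0 : 0 ≤ B := by
    obtain ⟨y⟩ := ρ.nonempty_of_neZero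
    exact (norm_nonneg _).trans (hB y)
  have hsq := integral_norm_sq_sub_mean_le ρ hn P hlaw hindep Φ hB
  refine le_of_sq_le_sq (le_trans ?_ hsq |>.trans_eq ?_) (by positivity)
  -- Nonnegativity of the variance bounds the squared first moment by the second moment.
  · have hvar := variance_nonneg (fun ω => ‖∫ y, Φ y ∂ρ - (n : ℝ)⁻¹ • ∑ k, Φ (x k ω)‖) P
    rw [variance_eq_sub ((memLp_two_iff_integrable_sq hint.aestronglyMeasurable).2 hint2)] at hvar
    simpa using hvar
  · rw [div_pow, Real.sq_sqrt (Nat.cast_nonneg n)]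

end MonteCarlo

/-! ### Assembling the error bound. -/

section Main

variable {𝒳 : Type u} [TopologicalSpace 𝒳] [CompactSpace 𝒳]

lemma abs_le_kernelSup (K : C(𝒳 × 𝒳, ℝ)) (p : 𝒳 × 𝒳) : |K p| ≤ kernelSup K :=
  le_ciSup (f := fun p => |K p|) (isCompact_range (by fun_prop)).bddAbove p

/-- Makes the estimator continuous in the sample points, hence integrable, with no regularity study
of matrix square roots. -/
lemma continuous_of_abs_sub_le {Y F : Type*} [TopologicalSpace Y] [NormedAddCommGroup F]
    {f : Y → ℝ} {u : Y → F} (hu : Continuous u) {C : ℝ}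
    (h : ∀ y z, |f y - f z| ≤ C * ‖u y - u z‖) : Continuous f := by
  refine continuous_iff_continuousAt.2 fun z => ?_
  rw [ContinuousAt, tendsto_iff_norm_sub_tendsto_zero]
  refine squeeze_zero (fun _ => norm_nonneg _) (fun y => h y z) ?_
  have hc : Continuous fun y => C * ‖u y - u z‖ := by fun_prop
  simpa using hc.tendsto z

variable [MeasurableSpace 𝒳] [BorelSpace 𝒳] [SecondCountableTopology 𝒳]

/-- The mean error of the marginal estimator over a compact second countable space. -/
theorem integral_abs_sub_estimator_le (ρ : Measure 𝒳) [IsProbabilityMeasure ρ]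
    {K₀ K₁ : C(𝒳 × 𝒳, ℝ)} (hK₀ : IsCovarianceKernel K₀) (hK₁ : IsCovarianceKernel K₁)
    {ε : ℝ} (hε : 0 < ε) {n : ℕ} (hn : 0 < n) {Ω : Type*} [MeasurableSpace Ω] (P : Measure Ω)
    [IsProbabilityMeasure P] {x : Fin n → Ω → 𝒳} (hlaw : ∀ i, HasLaw (x i) ρ P)
    (hindep : iIndepFun x P) :
    Integrable (fun ω => |entropicWassersteinSq ε (covarianceOperator ρ K₀)
        (covarianceOperator ρ K₁) - entropicWassersteinSqEstimator ε K₀ K₁ (fun i => x i ω)|) P ∧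
      ∫ ω, |entropicWassersteinSq ε (covarianceOperator ρ K₀) (covarianceOperator ρ K₁)
          - entropicWassersteinSqEstimator ε K₀ K₁ (fun i => x i ω)| ∂P
        ≤ (kernelSup K₀ + kernelSup K₁ + 4 / ε * kernelSup K₀ * kernelSup K₁) / √(n : ℝ) := by
  obtain ⟨H₀, _, _, _, φ₀, h₀⟩ := exists_feature K₀ hK₀
  obtain ⟨H₁, _, _, _, φ₁, h₁⟩ := exists_feature K₁ hK₁
  obtain ⟨W, b, -⟩ := exists_hilbertBasis ℝ H₀
  obtain ⟨y₀⟩ := ρ.nonempty_of_neZero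
  set κ₀ := kernelSup K₀ with hκ₀
  set κ₁ := kernelSup K₁ with hκ₁
  have hκ₀' : 0 ≤ κ₀ := (abs_nonneg _).trans (abs_le_kernelSup K₀ (y₀, y₀))
  have hκ₁' : 0 ≤ κ₁ := (abs_nonneg _).trans (abs_le_kernelSup K₁ (y₀, y₀))
  set B := √(κ₀ * κ₁) with hB
  have hBB : B * B = κ₀ * κ₁ := Real.mul_self_sqrt (mul_nonneg hκ₀' hκ₁')
  have hB0 : 0 ≤ B := Real.sqrt_nonneg _
  set Φ := tensorFeature b φ₀ φ₁ with hΦ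
  have hΦB (y : 𝒳) : ‖Φ y‖ ≤ B := by
    refine Real.le_sqrt_of_sq_le ?_
    rw [norm_tensorFeature_sq, ← real_inner_self_eq_norm_sq, ← real_inner_self_eq_norm_sq, h₀, h₁]
    exact mul_le_mul ((le_abs_self _).trans (abs_le_kernelSup K₀ _))
      ((le_abs_self _).trans (abs_le_kernelSup K₁ _))
      (by rw [← h₁, real_inner_self_eq_norm_sq]; positivity) hκ₀'
  set c := 16 / ε ^ 2 with hc
  have hc0 : 0 ≤ c := by positivity
  obtain ⟨s, hs, hval⟩ := exists_hasEntropicSum_covarianceOperator ρ h₀ h₁ b hε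
  choose t ht hval' using
    fun z : Fin n → 𝒳 => exists_hasEntropicSum_estimator hK₀ hK₁ h₀ h₁ b hε z
  set m := ∫ y, Φ y ∂ρ with hm
  set u : (Fin n → 𝒳) → lp (fun _ : W => H₁) 2 := fun z => (n : ℝ)⁻¹ • ∑ k, Φ (z k) with hu
  have hmB : ‖m‖ ≤ B := by
    simpa using norm_integral_le_of_norm_le_const (μ := ρ) (Filter.Eventually.of_forall hΦB)
  have huB (z : Fin n → 𝒳) : ‖u z‖ ≤ B := by
    have h1 : ‖∑ k, Φ (z k)‖ ≤ n * B := by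
      refine (norm_sum_le_of_le _ fun k _ => hΦB (z k)).trans_eq ?_
      simp
    have hnR : (0 : ℝ) < n := by positivity
    rw [hu]
    simp only
    rw [norm_smul, norm_inv, Real.norm_natCast, inv_mul_le_iff₀ hnR]
    exact h1
  -- Both means have norm at most `B`, so the factor `‖a + a'‖` costs `2 * B`.
  have hlip {a a' : lp (fun _ : W => H₁) 2} (ha : ‖a‖ ≤ B) (ha' : ‖a'‖ ≤ B) :
      c / 4 * (‖a - a'‖ * ‖a + a'‖) ≤ c / 2 * B * ‖a - a'‖ := by
    have h1 : ‖a + a'‖ ≤ 2 * B := (norm_add_le _ _).trans (by linarith)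
    calc c / 4 * (‖a - a'‖ * ‖a + a'‖) ≤ c / 4 * (‖a - a'‖ * (2 * B)) := by gcongr
      _ = c / 2 * B * ‖a - a'‖ := by ring
  have hucont : Continuous u := by fun_prop
  have htcont : Continuous t := continuous_of_abs_sub_le hucont fun y z =>
    ((ht y).abs_sub_le hc0 (ht z)).trans (hlip (huB y) (huB z))
  let D₀ : C(𝒳, ℝ) := ⟨fun y => K₀ (y, y), by fun_prop⟩
  let D₁ : C(𝒳, ℝ) := ⟨fun y => K₁ (y, y), by fun_prop⟩
  have hestcont : Continuous fun z : Fin n → 𝒳 => entropicWassersteinSqEstimator ε K₀ K₁ z := by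
    simp_rw [hval']
    fun_prop
  have hmeas : AEMeasurable (fun ω k => x k ω) P :=
    aemeasurable_pi_lambda _ fun k => (hlaw k).aemeasurable
  have hint := integrable_comp_of_continuous hmeas
    (g := fun z : Fin n → 𝒳 => |entropicWassersteinSq ε (covarianceOperator ρ K₀)
        (covarianceOperator ρ K₁) - entropicWassersteinSqEstimator ε K₀ K₁ z|) (by fun_prop)
  refine ⟨hint, ?_⟩
  obtain ⟨hi₀, he₀⟩ := integral_norm_sub_mean_le ρ hn P hlaw hindep D₀
    (fun y => abs_le_kernelSup K₀ (y, y))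
  obtain ⟨hi₁, he₁⟩ := integral_norm_sub_mean_le ρ hn P hlaw hindep D₁
    (fun y => abs_le_kernelSup K₁ (y, y))
  obtain ⟨hi, he⟩ := integral_norm_sub_mean_le ρ hn P hlaw hindep Φ hΦB
  have hbound (z : Fin n → 𝒳) : |entropicWassersteinSq ε (covarianceOperator ρ K₀)
        (covarianceOperator ρ K₁) - entropicWassersteinSqEstimator ε K₀ K₁ z|
      ≤ ‖∫ y, D₀ y ∂ρ - (n : ℝ)⁻¹ • ∑ k, D₀ (z k)‖ + ‖∫ y, D₁ y ∂ρ - (n : ℝ)⁻¹ • ∑ k, D₁ (z k)‖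
        + 4 / ε * B * ‖m - u z‖ := by
    have h2 : |s - t z| ≤ c / 2 * B * ‖m - u z‖ :=
      (hs.abs_sub_le hc0 (ht z)).trans (hlip hmB (huB z))
    -- With `c = 16 / ε²`, the constant is `ε / 2 * (c / 2) = 4 / ε`; a second factor `B` comes from
    -- the mean error, and `B * B = κ₀ * κ₁`.
    have h3 : ε / 2 * |s - t z| ≤ 4 / ε * B * ‖m - u z‖ := by
      refine (mul_le_mul_of_nonneg_left h2 (by positivity)).trans_eq ?_
      rw [hc]
      field_simp
      ring
    rw [hval, hval']
    have h4 : ∫ y, K₀ (y, y) ∂ρ + ∫ y, K₁ (y, y) ∂ρ - ε / 2 * s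
        - ((n : ℝ)⁻¹ • ∑ k, K₀ (z k, z k) + (n : ℝ)⁻¹ • ∑ k, K₁ (z k, z k) - ε / 2 * t z)
        = (∫ y, D₀ y ∂ρ - (n : ℝ)⁻¹ • ∑ k, D₀ (z k)) + (∫ y, D₁ y ∂ρ - (n : ℝ)⁻¹ • ∑ k, D₁ (z k))
          - ε / 2 * (s - t z) := by
      simp only [D₀, D₁, ContinuousMap.coe_mk]
      ring
    rw [h4]
    refine (abs_sub _ _).trans (add_le_add (abs_add_le _ _) ?_)
    rwa [abs_mul, abs_of_pos (by positivity)]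
  calc ∫ ω, |entropicWassersteinSq ε (covarianceOperator ρ K₀) (covarianceOperator ρ K₁)
          - entropicWassersteinSqEstimator ε K₀ K₁ (fun i => x i ω)| ∂P
      ≤ ∫ ω, (‖∫ y, D₀ y ∂ρ - (n : ℝ)⁻¹ • ∑ k, D₀ (x k ω)‖
          + ‖∫ y, D₁ y ∂ρ - (n : ℝ)⁻¹ • ∑ k, D₁ (x k ω)‖
          + 4 / ε * B * ‖m - (n : ℝ)⁻¹ • ∑ k, Φ (x k ω)‖) ∂P :=
        integral_mono hint ((hi₀.add hi₁).add (hi.const_mul _)) fun ω => hbound _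
    _ ≤ κ₀ / √(n : ℝ) + κ₁ / √(n : ℝ) + 4 / ε * B * (B / √(n : ℝ)) := by
        refine (integral_add (hi₀.add hi₁) (hi.const_mul _)).trans_le
          (add_le_add ((integral_add hi₀ hi₁).trans_le (add_le_add he₀ he₁)) ?_)
        rw [integral_const_mul]
        exact mul_le_mul_of_nonneg_left he (by positivity)
    _ = (κ₀ + κ₁ + 4 / ε * κ₀ * κ₁) / √(n : ℝ) := by
        rw [mul_assoc (4 / ε) κ₀ κ₁, ← hBB]
        ring

end Main

end EntropicW

theorem mainTheorem2 {d : ℕ} (𝒳 : Set (EuclideanSpace ℝ (Fin d))) [CompactSpace 𝒳]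
    (ρ : Measure 𝒳) [IsProbabilityMeasure ρ]
    (K₀ K₁ : C(𝒳 × 𝒳, ℝ))
    (hK₀ : EntropicW.IsCovarianceKernel K₀) (hK₁ : EntropicW.IsCovarianceKernel K₁)
    (ε : ℝ) (hε : 0 < ε) (n : ℕ) (hn : 0 < n)
    {Ω : Type*} [MeasurableSpace Ω] (P : Measure Ω) [IsProbabilityMeasure P]
    (x : Fin n → Ω → 𝒳) (hlaw : ∀ i, HasLaw (x i) ρ P) (hindep : iIndepFun x P) :
    Integrable (fun ω =>
        |EntropicW.entropicWassersteinSq ε (EntropicW.covarianceOperator ρ K₀)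
            (EntropicW.covarianceOperator ρ K₁)
          - EntropicW.entropicWassersteinSqEstimator ε K₀ K₁ (fun i => x i ω)|) P ∧
      ∫ ω, |EntropicW.entropicWassersteinSq ε (EntropicW.covarianceOperator ρ K₀)
            (EntropicW.covarianceOperator ρ K₁)
          - EntropicW.entropicWassersteinSqEstimator ε K₀ K₁ (fun i => x i ω)| ∂P
        ≤ (EntropicW.kernelSup K₀ + EntropicW.kernelSup K₁
            + 8 / ε * EntropicW.kernelSup K₀ * EntropicW.kernelSup K₁) / √(n : ℝ) := by
  obtain ⟨hint, hle⟩ := EntropicW.integral_abs_sub_estimator_le ρ hK₀ hK₁ hε hn P hlaw hindep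
  refine ⟨hint, hle.trans ?_⟩
  obtain ⟨y⟩ := ρ.nonempty_of_neZero
  have h₀ := (abs_nonneg _).trans (EntropicW.abs_le_kernelSup K₀ (y, y))
  have h₁ := (abs_nonneg _).trans (EntropicW.abs_le_kernelSup K₁ (y, y))
  -- The argument yields the sharper constant `4 / ε`; passing to `8 / ε` uses that both suprema are
  -- nonnegative.
  gcongr
  norm_num
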